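/- Let $\Sigma_k=\{1<2<\cdots<k\}$, and let $\Sigma_k^n$ be the set of words of length $n$ over $\Sigma_k$. A word is \emph{bordered} if it has a non-empty proper prefix that is also a suffix of it. The \emph{rank} of a bordered word $w\in\Sigma_k^n$ is its position, counted from $1$, in the list of all bordered words of $\Sigma_k^n$ in lexicographic order. The computational model is the unit-cost RAM: every register holds an arbitrarily large non-negative integer and counts as one unit of space, and every instruction (addition, truncated subtraction, multiplication, integer division, copying, direct and indirect access, comparison and jump) takes one unit of time. There is a single unit-cost RAM program that, for all integers $n\ge 1$ and $k\ge 2$ and every rank $r$ of a bordered word of $\Sigma_k^n$, computes from the input $(r,n,k)$ the bordered word $w\in\Sigma_k^n$ with rank $r$ in $O(n^4k\log k)$ time using $O(n)$ space, where the implied constants are absolute. -/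

import Mathlib

/-! ### Words and borders -/

/-- The ordered alphabet `Σ_k = {1 < 2 < ⋯ < k}`. -/
abbrev Letter (k : ℕ) : Type := {c : ℕ // c ∈ Finset.Icc 1 k}

/-- `u` is a border of `w`: a non-empty proper prefix of `w` that is also a suffix of `w`. -/
def IsBorder {α : Type*} (u w : List α) : Prop :=
  u ≠ [] ∧ u ≠ w ∧ u <+: w ∧ u <:+ w

/-- A word is bordered if it has a border. -/
def Bordered {α : Type*} (w : List α) : Prop :=
  ∃ u, IsBorder u w

/-- `Σ_k^n`: all words of length `n` over `Σ_k`. -/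
def words (n k : ℕ) : Finset (List (Letter k)) :=
  (Finset.univ : Finset (Fin n → Letter k)).image List.ofFn

open Classical in
/-- The list of all bordered words of length `n` over `Σ_k`, in increasing lexicographic order
(the order on lists is the lexicographic one). -/
noncomputable def borderedListing (n k : ℕ) : List (List (Letter k)) :=
  ((words n k).filter Bordered).sort (· ≤ ·)

/-- The rank of a bordered word `w` over `Σ_k`: its position, counted from `1`, in the
lexicographic listing of the bordered words of the same length. -/
noncomputable def rankB {k : ℕ} (w : List (Letter k)) : ℕ :=
  (borderedListing w.length k).idxOf w + 1

/-! ### The unit-cost random access machine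

A memory is an unbounded sequence of registers, each holding an arbitrarily large natural number.
Every instruction, arithmetic included, takes one time unit, and every register is one unit of
space. -/

namespace RAM

/-- Instructions. Parameters `d a b` are register addresses, `c` is a constant, `l` is a position
in the program. Writing `R[a]` for the content of register `a`: -/
inductive Instr : Type
  /-- `R[d] := c` -/
  | const (d c : ℕ)
  /-- `R[d] := R[a]` -/
  | copy (d a : ℕ)
  /-- `R[d] := R[a] + R[b]` -/
  | add (d a b : ℕ)
  /-- `R[d] := max (R[a] - R[b]) 0` -/
  | sub (d a b : ℕ)
  /-- `R[d] := R[a] * R[b]` -/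
  | mul (d a b : ℕ)
  /-- `R[d] := ⌊R[a] / R[b]⌋` (and `0` if `R[b] = 0`) -/
  | div (d a b : ℕ)
  /-- indirect read, `R[d] := R[R[a]]` -/
  | load (d a : ℕ)
  /-- indirect write, `R[R[d]] := R[a]` -/
  | store (d a : ℕ)
  /-- continue at position `l` -/
  | jump (l : ℕ)
  /-- continue at position `l` if `R[a] ≤ R[b]` -/
  | jumpLE (a b l : ℕ)

/-- A program is a finite list of instructions, at positions `0, 1, 2, …`. -/
abbrev Program : Type := List Instr

/-- A configuration: the position of the next instruction and the content of the memory. -/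
structure Config : Type where
  pc : ℕ
  mem : ℕ → ℕ

/-- Write `v` to register `d` and go on to the next instruction. -/
def Config.write (s : Config) (d v : ℕ) : Config :=
  ⟨s.pc + 1, Function.update s.mem d v⟩

/-- The effect of one instruction. -/
def Instr.exec : Instr → Config → Config
  | const d c, s => s.write d c
  | copy d a, s => s.write d (s.mem a)
  | add d a b, s => s.write d (s.mem a + s.mem b)
  | sub d a b, s => s.write d (s.mem a - s.mem b)
  | mul d a b, s => s.write d (s.mem a * s.mem b)
  | div d a b, s => s.write d (s.mem a / s.mem b)
  | load d a, s => s.write d (s.mem (s.mem a))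
  | store d a, s => s.write (s.mem d) (s.mem a)
  | jump l, s => ⟨l, s.mem⟩
  | jumpLE a b l, s => ⟨if s.mem a ≤ s.mem b then l else s.pc + 1, s.mem⟩

/-- The addresses of the registers that one instruction reads or writes. -/
def Instr.touched : Instr → Config → Finset ℕ
  | const d _, _ => {d}
  | copy d a, _ => {d, a}
  | add d a b, _ => {d, a, b}
  | sub d a b, _ => {d, a, b}
  | mul d a b, _ => {d, a, b}
  | div d a b, _ => {d, a, b}
  | load d a, s => {d, a, s.mem a}
  | store d a, s => {d, a, s.mem d}
  | jump _, _ => ∅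
  | jumpLE a b _, _ => {a, b}

/-- The machine has halted when there is no instruction at the current position. -/
def Halted (P : Program) (s : Config) : Prop :=
  P.length ≤ s.pc

/-- One step (a halted machine stays as it is). -/
def step (P : Program) (s : Config) : Config :=
  match P[s.pc]? with
  | some i => i.exec s
  | none => s

/-- The addresses of the registers that are read or written in one step. -/
def touched (P : Program) (s : Config) : Finset ℕ :=
  match P[s.pc]? with
  | some i => i.touched s
  | none => ∅

/-- The configuration after `t` steps. -/
def run (P : Program) (s : Config) (t : ℕ) : Config :=
  (step P)^[t] s

/-- The initial configuration: the input is in registers `0, 1, 2, …`, all others hold `0`. -/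
def init (input : List ℕ) : Config :=
  ⟨0, fun a => input.getD a 0⟩

/-- Started on `input`, the program halts after at most `T` steps with the finite sequence `output`
stored in consecutive registers from the address given by register `0` on, and all registers
that hold input or output or are read or written during the computation have an address below `S`
(so that at most `S` registers are used). -/
def Computes (P : Program) (input output : List ℕ) (T S : ℝ) : Prop :=
  ∃ t : ℕ, (t : ℝ) ≤ T ∧
    Halted P (run P (init input) t) ∧
    (∀ i : Fin output.length,
      (run P (init input) t).mem ((run P (init input) t).mem 0 + i) = output.get i) ∧
    (input.length : ℝ) ≤ S ∧
    (((run P (init input) t).mem 0 + output.length : ℕ) : ℝ) ≤ S ∧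
    ∀ s < t, ∀ a ∈ touched P (run P (init input) s), (a : ℝ) < S

end RAM

/-!
Read the letters `1, …, k` as base-`k` digits `0, …, k - 1`. Words of length `n` become the numbers
`x < k ^ n`, lexicographic order becomes the order of numbers, and `x` has a border of length `i`
if and only if `x / k ^ (n - i) = x % k ^ i` (`Brd`, `bordered_iff`, `rankB_eq`). Finding the word
of rank `r` means finding the bordered `x < k ^ n` below which there are `r - 1` bordered numbers.

**Counting.** The shortest border of a word is unbordered, at most half as long as the word, and
unique. Classifying the bordered words of length `j` with a given prefix `p` by their shortest
border expresses the number of unbordered words of length `j` comparable to `p` through the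
corresponding numbers for lengths at most `j / 2` (`unbordered_add_sum`). The coefficients, which
count the words comparable to `p` with a given border, have a closed form (`card_border_eq`), so
that tabulating the recurrence takes `O(n ^ 3)` steps (`RAM.Comp.unbordered`).

**Search.** The word is found letter by letter: at each of the `n` positions the at most `k`
candidates are tried in increasing order, and the number of bordered words with the prefix at hand
is subtracted from the rank as long as it does not exceed what is left (`RAM.Comp.unrank`). This
takes `O(n ^ 4 * k)` steps, which is within the bound because `log k ≥ log 2`.

**The machine.** `RAM.Comp D Γ f B` says that there is code computing `f` from the values `g ∈ Γ`
in time `O(B)`, with a fixed number of registers, wherever the code and its data are placed. It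
is closed under arithmetic, branching, local definitions and bounded loops, and loop invariants are
stated as equations between the functions involved. The table of the recurrence is kept in a
single register, as the digits of one large number, which the unit-cost model permits; apart
from the `n` registers of the output only constantly many registers are used.
-/

/-! ### Code fragments and runs of the machine -/

namespace RAM

/-- The code `l` stands in the program `P` from position `b` on. -/
def CodeAt (P : Program) (b : ℕ) (l : List Instr) : Prop :=
  ∀ i < l.length, P[b + i]? = l[i]?

theorem codeAt_append {P : Program} {b : ℕ} {l l' : List Instr} :
    CodeAt P b (l ++ l') ↔ CodeAt P b l ∧ CodeAt P (b + l.length) l' := by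
  constructor
  · intro h
    refine ⟨fun i hi => ?_, fun i hi => ?_⟩
    · have := h i (by simp; omega)
      rwa [List.getElem?_append_left hi] at this
    · have := h (l.length + i) (by simp; omega)
      rw [List.getElem?_append_right (by omega)] at this
      simpa [Nat.add_assoc] using this
  · rintro ⟨h, h'⟩ i hi
    rcases lt_or_ge i l.length with hc | hc
    · rw [List.getElem?_append_left hc]
      exact h i hc
    · rw [List.getElem?_append_right hc]
      have := h' (i - l.length) (by simp at hi; omega)
      rwa [Nat.add_assoc, Nat.add_sub_cancel' hc] at this

theorem codeAt_cons {P : Program} {b : ℕ} {i : Instr} {l : List Instr} :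
    CodeAt P b (i :: l) ↔ P[b]? = some i ∧ CodeAt P (b + 1) l := by
  rw [← List.singleton_append, codeAt_append]
  simp [CodeAt]

theorem codeAt_self (P : Program) : CodeAt P 0 P := by
  simp [CodeAt]

/-- The machine gets from `s` to `s'` in at most `T` steps, and touches only registers below `K`
on the way. The last clause follows from this, but is convenient to carry along. -/
def Reaches (P : Program) (K : ℕ) (s s' : Config) (T : ℕ) : Prop :=
  ∃ t ≤ T, run P s t = s' ∧ (∀ i < t, ∀ a ∈ touched P (run P s i), a < K) ∧
    ∀ a, K ≤ a → s'.mem a = s.mem a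

theorem Reaches.refl (P : Program) (K : ℕ) (s : Config) : Reaches P K s s 0 :=
  ⟨0, le_rfl, rfl, by simp, by simp⟩

theorem Reaches.trans {P : Program} {K : ℕ} {s s' s'' : Config} {T T' : ℕ}
    (h : Reaches P K s s' T) (h' : Reaches P K s' s'' T') : Reaches P K s s'' (T + T') := by
  obtain ⟨t, ht, hr, ha, hm⟩ := h
  obtain ⟨t', ht', hr', ha', hm'⟩ := h'
  have key : ∀ i, run P s (i + t) = run P s' i := fun i => by
    rw [← hr]; exact Function.iterate_add_apply _ _ _ _
  refine ⟨t' + t, by omega, by rw [key, hr'], fun i hi => ?_, fun a hK => ?_⟩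
  · rcases lt_or_ge i t with h | h
    · exact ha i h
    · obtain ⟨j, rfl⟩ := Nat.exists_eq_add_of_le' h
      rw [key]
      exact ha' j (by omega)
  · rw [hm' a hK, hm a hK]

theorem Reaches.mono {P : Program} {K K' : ℕ} {s s' : Config} {T T' : ℕ}
    (h : Reaches P K s s' T) (hK : K ≤ K') (hT : T ≤ T') : Reaches P K' s s' T' := by
  obtain ⟨t, ht, hr, ha, hm⟩ := h
  exact ⟨t, ht.trans hT, hr, fun i hi a h => (ha i hi a h).trans_le hK,
    fun a h => hm a (hK.trans h)⟩

/-- An instruction other than a jump is one step that writes one register. -/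
theorem Reaches.write {P : Program} {K b d v : ℕ} {m : ℕ → ℕ} {i : Instr} (hP : P[b]? = some i)
    (hi : i.exec ⟨b, m⟩ = ⟨b + 1, Function.update m d v⟩)
    (ht : ∀ a ∈ i.touched ⟨b, m⟩, a < K) (hd : d < K) :
    Reaches P K ⟨b, m⟩ ⟨b + 1, Function.update m d v⟩ 1 := by
  refine ⟨1, le_rfl, ?_, ?_, fun a ha => ?_⟩
  · simp [run, step, hP, hi]
  · intro j hj a ha
    obtain rfl : j = 0 := by omega
    simp only [run, touched, Function.iterate_zero, id, hP] at ha
    exact ht a ha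
  · exact Function.update_of_ne (by omega) _ _

theorem Reaches.jump {P : Program} {K b l : ℕ} {m : ℕ → ℕ} (hP : P[b]? = some (.jump l)) :
    Reaches P K ⟨b, m⟩ ⟨l, m⟩ 1 := by
  refine ⟨1, le_rfl, ?_, ?_, fun a ha => rfl⟩
  · simp [run, step, hP, Instr.exec]
  · intro j hj a ha
    obtain rfl : j = 0 := by omega
    simp [run, touched, hP, Instr.touched] at ha

theorem Reaches.jumpLE {P : Program} {K b x y l : ℕ} {m : ℕ → ℕ}
    (hP : P[b]? = some (.jumpLE x y l)) (hx : x < K) (hy : y < K) :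
    Reaches P K ⟨b, m⟩ ⟨if m x ≤ m y then l else b + 1, m⟩ 1 := by
  refine ⟨1, le_rfl, ?_, ?_, fun a ha => rfl⟩
  · simp [run, step, hP, Instr.exec]
  · intro j hj a ha
    obtain rfl : j = 0 := by omega
    simp only [run, touched, Function.iterate_zero, id, hP, Instr.touched, Finset.mem_insert,
      Finset.mem_singleton] at ha
    omega

/-! ### Computability of functions with a time bound -/

/-- The value `f e` is computable in time `O(B e)`, uniformly in `e ∈ D`, from the values `g e`
for `g ∈ Γ`: wherever these values are kept (`g e` in register `ρ g`), and for every `s` above all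
these registers, there is code, to be placed at position `b`, which leaves `f e` in register `s` and
changes no register below `s`.

The type `E` is that of the data on which everything depends; its elements may carry
components that no `g ∈ Γ` gives access to, as auxiliary data for specifications. The bound
`1 ≤ B e` lets constant costs be absorbed. The address bound `K` does not
depend on `e`, so a computation of this kind uses constantly many registers. -/
def Comp {E : Type*} (D : Set E) (Γ : Set (E → ℕ)) (f B : E → ℕ) : Prop :=
  (∀ e ∈ D, 1 ≤ B e) ∧
  ∀ (ρ : (E → ℕ) → ℕ) (s b : ℕ), (∀ g ∈ Γ, ρ g < s) →
    ∃ (code : List Instr) (K c : ℕ), s < K ∧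
      ∀ P, CodeAt P b code → ∀ e ∈ D, ∀ m : ℕ → ℕ, (∀ g ∈ Γ, m (ρ g) = g e) →
        ∃ m', Reaches P K ⟨b, m⟩ ⟨b + code.length, m'⟩ (c * B e) ∧ m' s = f e ∧
          ∀ a < s, m' a = m a

namespace Comp

variable {E : Type*} {D : Set E} {Γ : Set (E → ℕ)} {f g B : E → ℕ}

theorem congr (hf : Comp D Γ f B) (h : ∀ e ∈ D, f e = g e) : Comp D Γ g B := by
  refine ⟨hf.1, fun ρ s b hρ => ?_⟩
  obtain ⟨code, K, c, hK, H⟩ := hf.2 ρ s b hρ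
  refine ⟨code, K, c, hK, fun P hP e he m hm => ?_⟩
  obtain ⟨m', h1, h2, h3⟩ := H P hP e he m hm
  exact ⟨m', h1, by rw [h2, h e he], h3⟩

theorem mono_time {B' : E → ℕ} (hf : Comp D Γ f B) (C : ℕ) (h : ∀ e ∈ D, B e ≤ C * B' e) :
    Comp D Γ f B' := by
  refine ⟨fun e he => Nat.pos_of_ne_zero fun h0 => ?_, fun ρ s b hρ => ?_⟩
  · have := h e he
    have := hf.1 e he
    simp only [h0, mul_zero] at *
    omega
  obtain ⟨code, K, c, hK, H⟩ := hf.2 ρ s b hρ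
  refine ⟨code, K, c * C, hK, fun P hP e he m hm => ?_⟩
  obtain ⟨m', h1, h2, h3⟩ := H P hP e he m hm
  refine ⟨m', h1.mono le_rfl ?_, h2, h3⟩
  rw [mul_assoc]
  exact Nat.mul_le_mul_left _ (h e he)

/-- Substitution: a computation on `E'` can be used on `E` along a map whose
components are at hand. -/
theorem pull {E' : Type*} {D' : Set E'} {Γ' : Set (E' → ℕ)} {f' B' : E' → ℕ}
    (h : Comp D' Γ' f' B') (φ : E → E') (hD : ∀ e ∈ D, φ e ∈ D')
    (hΓ : ∀ g ∈ Γ', g ∘ φ ∈ Γ) : Comp D Γ (f' ∘ φ) (B' ∘ φ) := by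
  refine ⟨fun e he => h.1 _ (hD e he), fun ρ s b hρ => ?_⟩
  obtain ⟨code, K, c, hK, H⟩ := h.2 (fun g => ρ (g ∘ φ)) s b fun g hg => hρ _ (hΓ g hg)
  refine ⟨code, K, c, hK, fun P hP e he m hm => ?_⟩
  exact H P hP (φ e) (hD e he) m fun g hg => hm _ (hΓ g hg)

theorem weaken {Γ' : Set (E → ℕ)} (hf : Comp D Γ f B) (h : Γ ⊆ Γ') : Comp D Γ' f B :=
  hf.pull id (fun _ he => he) fun _ hg => h hg

theorem var (hB : ∀ e ∈ D, 1 ≤ B e) (hg : g ∈ Γ) : Comp D Γ g B := by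
  refine ⟨hB, fun ρ s b hρ => ⟨[.copy s (ρ g)], s + 1, 1, by omega, fun P hP e he m hm => ?_⟩⟩
  have hs := hρ g hg
  refine ⟨Function.update m s (g e), ?_, by simp, fun a ha => Function.update_of_ne (by omega) _ _⟩
  refine (Reaches.write (codeAt_cons.1 hP).1 ?_ ?_ (by omega)).mono le_rfl ?_
  · simp [Instr.exec, Config.write, hm g hg]
  · simp [Instr.touched]; omega
  · simpa using hB e he

theorem const (hB : ∀ e ∈ D, 1 ≤ B e) (x : ℕ) : Comp D Γ (fun _ => x) B := by
  refine ⟨hB, fun ρ s b hρ => ⟨[.const s x], s + 1, 1, by omega, fun P hP e he m hm => ?_⟩⟩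
  refine ⟨Function.update m s x, ?_, by simp, fun a ha => Function.update_of_ne (by omega) _ _⟩
  refine (Reaches.write (codeAt_cons.1 hP).1 ?_ ?_ (by omega)).mono le_rfl ?_
  · simp [Instr.exec, Config.write]
  · simp [Instr.touched]
  · simpa using hB e he

/-- A computed value may be kept in a register for use in what follows. -/
theorem keep (hf : Comp D Γ f B) (hg : Comp D (insert f Γ) g B) : Comp D Γ g B := by
  classical
  refine ⟨hf.1, fun ρ s b hρ => ?_⟩
  obtain ⟨c₁, K₁, t₁, hK₁, H₁⟩ := hf.2 ρ s b hρ
  have hρ' : ∀ h ∈ insert f Γ, Function.update ρ f s h < s + 1 := by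
    intro h hh
    by_cases hf : h = f
    · simp [hf]
    · rw [Function.update_of_ne hf]
      exact (hρ h (hh.resolve_left hf)).trans (by omega)
  obtain ⟨c₂, K₂, t₂, hK₂, H₂⟩ := hg.2 (Function.update ρ f s) (s + 1) (b + c₁.length) hρ'
  refine ⟨c₁ ++ c₂ ++ [.copy s (s + 1)], max K₁ K₂, t₁ + t₂ + 1, by omega,
    fun P hP e he m hm => ?_⟩
  rw [codeAt_append, codeAt_append] at hP
  obtain ⟨⟨hP₁, hP₂⟩, hP₃⟩ := hP
  obtain ⟨m₁, r₁, v₁, p₁⟩ := H₁ P hP₁ e he m hm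
  have hm₁ : ∀ h ∈ insert f Γ, m₁ (Function.update ρ f s h) = h e := by
    intro h hh
    by_cases hf : h = f
    · simp [hf, v₁]
    · rw [Function.update_of_ne hf, p₁ _ (hρ h (hh.resolve_left hf))]
      exact hm h (hh.resolve_left hf)
  obtain ⟨m₂, r₂, v₂, p₂⟩ := H₂ P hP₂ e he m₁ hm₁
  have r₃ : Reaches P (max K₁ K₂) ⟨b + (c₁ ++ c₂).length, m₂⟩ ⟨b + (c₁ ++ c₂).length + 1,
      Function.update m₂ s (g e)⟩ 1 := by
    refine Reaches.write (codeAt_cons.1 hP₃).1 ?_ ?_ (by omega)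
    · simp [Instr.exec, Config.write, v₂]
    · simp [Instr.touched]; omega
  refine ⟨Function.update m₂ s (g e), ?_, by simp, fun a ha => ?_⟩
  · have r₁' := r₁.mono (le_max_left K₁ K₂) le_rfl
    have r₂' := r₂.mono (le_max_right K₁ K₂) le_rfl
    simp only [List.length_append, ← Nat.add_assoc, List.length_singleton] at r₃ ⊢
    refine ((r₁'.trans r₂').trans r₃).mono le_rfl ?_
    nlinarith [hf.1 e he]
  · rw [Function.update_of_ne (by omega), p₂ a (by omega), p₁ a ha]

/-- Binary instructions: the operands are computed into the registers `s` and `s + 1`. -/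
theorem binop {ins : ℕ → ℕ → ℕ → Instr} {F : ℕ → ℕ → ℕ}
    (hi : ∀ d x y s, (ins d x y).exec s = s.write d (F (s.mem x) (s.mem y)))
    (ht : ∀ d x y s, (ins d x y).touched s = {d, x, y})
    (hf : Comp D Γ f B) (hg : Comp D Γ g B) : Comp D Γ (fun e => F (f e) (g e)) B := by
  refine ⟨hf.1, fun ρ s b hρ => ?_⟩
  obtain ⟨c₁, K₁, t₁, hK₁, H₁⟩ := hf.2 ρ s b hρ
  obtain ⟨c₂, K₂, t₂, hK₂, H₂⟩ := hg.2 ρ (s + 1) (b + c₁.length)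
    fun g hg => (hρ g hg).trans (by omega)
  refine ⟨c₁ ++ c₂ ++ [ins s s (s + 1)], max K₁ K₂, t₁ + t₂ + 1, by omega,
    fun P hP e he m hm => ?_⟩
  rw [codeAt_append, codeAt_append] at hP
  obtain ⟨⟨hP₁, hP₂⟩, hP₃⟩ := hP
  obtain ⟨m₁, r₁, v₁, p₁⟩ := H₁ P hP₁ e he m hm
  obtain ⟨m₂, r₂, v₂, p₂⟩ := H₂ P hP₂ e he m₁ fun g hg => by rw [p₁ _ (hρ g hg), hm g hg]
  have r₃ : Reaches P (max K₁ K₂) ⟨b + (c₁ ++ c₂).length, m₂⟩ ⟨b + (c₁ ++ c₂).length + 1,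
      Function.update m₂ s (F (f e) (g e))⟩ 1 := by
    refine Reaches.write (codeAt_cons.1 hP₃).1 ?_ ?_ (by omega)
    · rw [hi]
      simp [Config.write, v₂, p₂ s (by omega), v₁]
    · rw [ht]
      simp only [Finset.mem_insert, Finset.mem_singleton]
      omega
  refine ⟨Function.update m₂ s (F (f e) (g e)), ?_, by simp, fun a ha => ?_⟩
  · have r₁' := r₁.mono (le_max_left K₁ K₂) le_rfl
    have r₂' := r₂.mono (le_max_right K₁ K₂) le_rfl
    simp only [List.length_append, ← Nat.add_assoc, List.length_singleton] at r₃ ⊢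
    refine ((r₁'.trans r₂').trans r₃).mono le_rfl ?_
    nlinarith [hf.1 e he]
  · rw [Function.update_of_ne (by omega), p₂ a (by omega), p₁ a ha]

theorem add (hf : Comp D Γ f B) (hg : Comp D Γ g B) : Comp D Γ (fun e => f e + g e) B :=
  binop (ins := .add) (F := (· + ·)) (fun _ _ _ _ => rfl) (fun _ _ _ _ => rfl) hf hg

theorem sub (hf : Comp D Γ f B) (hg : Comp D Γ g B) : Comp D Γ (fun e => f e - g e) B :=
  binop (ins := .sub) (F := (· - ·)) (fun _ _ _ _ => rfl) (fun _ _ _ _ => rfl) hf hg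

theorem mul (hf : Comp D Γ f B) (hg : Comp D Γ g B) : Comp D Γ (fun e => f e * g e) B :=
  binop (ins := .mul) (F := (· * ·)) (fun _ _ _ _ => rfl) (fun _ _ _ _ => rfl) hf hg

theorem div (hf : Comp D Γ f B) (hg : Comp D Γ g B) : Comp D Γ (fun e => f e / g e) B :=
  binop (ins := .div) (F := (· / ·)) (fun _ _ _ _ => rfl) (fun _ _ _ _ => rfl) hf hg

theorem mod (hf : Comp D Γ f B) (hg : Comp D Γ g B) : Comp D Γ (fun e => f e % g e) B :=
  (hf.sub (hg.mul (hf.div hg))).congr fun e _ => by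
    have := Nat.mod_add_div (f e) (g e)
    omega

theorem ite_le {x y : E → ℕ} (hx : Comp D Γ x B) (hy : Comp D Γ y B) (hf : Comp D Γ f B)
    (hg : Comp D Γ g B) : Comp D Γ (fun e => if x e ≤ y e then f e else g e) B := by
  refine ⟨hf.1, fun ρ s b hρ => ?_⟩
  obtain ⟨c₁, K₁, t₁, hK₁, H₁⟩ := hx.2 ρ s b hρ
  obtain ⟨c₂, K₂, t₂, hK₂, H₂⟩ := hy.2 ρ (s + 1) (b + c₁.length)
    fun g hg => (hρ g hg).trans (by omega)
  obtain ⟨c₃, K₃, t₃, hK₃, H₃⟩ := hg.2 ρ s (b + c₁.length + c₂.length + 1) hρ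
  obtain ⟨c₄, K₄, t₄, hK₄, H₄⟩ := hf.2 ρ s
    (b + c₁.length + c₂.length + 1 + c₃.length + 1) hρ
  set K := max (max K₁ K₂) (max K₃ K₄)
  set L := b + c₁.length + c₂.length + 1 + c₃.length + 1
  refine ⟨c₁ ++ c₂ ++ [Instr.jumpLE s (s + 1) L] ++ c₃ ++ [Instr.jump (L + c₄.length)] ++ c₄, K,
    t₁ + t₂ + t₃ + t₄ + 2, by omega, fun P hP e he m hm => ?_⟩
  simp only [codeAt_append, codeAt_cons, List.length_append, List.length_singleton,
    ← Nat.add_assoc] at hP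
  obtain ⟨⟨⟨⟨⟨hP₁, hP₂⟩, hj, -⟩, hP₃⟩, hj', -⟩, hP₄⟩ := hP
  obtain ⟨m₁, r₁, v₁, p₁⟩ := H₁ P hP₁ e he m hm
  obtain ⟨m₂, r₂, v₂, p₂⟩ := H₂ P hP₂ e he m₁ fun g hg => by rw [p₁ _ (hρ g hg), hm g hg]
  have p₂' : ∀ a < s, m₂ a = m a := fun a ha => by rw [p₂ a (by omega), p₁ a ha]
  have hm₂ : ∀ g ∈ Γ, m₂ (ρ g) = g e := fun g hg => by rw [p₂' _ (hρ g hg), hm g hg]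
  have r₁' := r₁.mono (show K₁ ≤ K by omega) le_rfl
  have r₂' := r₂.mono (show K₂ ≤ K by omega) le_rfl
  have rj := Reaches.jumpLE (K := K) (m := m₂) hj (by omega) (by omega)
  rw [v₂, p₂ s (by omega), v₁] at rj
  have hB := hf.1 e he
  have hend : b + (c₁ ++ c₂ ++ [Instr.jumpLE s (s + 1) L] ++ c₃ ++ [Instr.jump (L + c₄.length)] ++
      c₄).length = L + c₄.length := by
    simp only [List.length_append, List.length_singleton]
    omega
  rw [hend]
  split_ifs at rj ⊢ with hxy
  · obtain ⟨m₄, r₄, v₄, p₄⟩ := H₄ P hP₄ e he m₂ hm₂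
    refine ⟨m₄, ?_, by simp [hxy, v₄], fun a ha => by rw [p₄ a ha, p₂' a ha]⟩
    have r₄' := r₄.mono (show K₄ ≤ K by omega) le_rfl
    refine (((r₁'.trans r₂').trans rj).trans r₄').mono le_rfl ?_
    nlinarith
  · obtain ⟨m₃, r₃, v₃, p₃⟩ := H₃ P hP₃ e he m₂ hm₂
    refine ⟨m₃, ?_, by simp [hxy, v₃], fun a ha => by rw [p₃ a ha, p₂' a ha]⟩
    have r₃' := r₃.mono (show K₃ ≤ K by omega) le_rfl
    refine ((((r₁'.trans r₂').trans rj).trans r₃').trans (Reaches.jump hj')).mono le_rfl ?_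
    nlinarith

theorem ite_eq {x y : E → ℕ} (hx : Comp D Γ x B) (hy : Comp D Γ y B) (hf : Comp D Γ f B)
    (hg : Comp D Γ g B) : Comp D Γ (fun e => if x e = y e then f e else g e) B :=
  (hx.ite_le hy (hy.ite_le hx hf hg) hg).congr fun e _ => by
    split_ifs <;> first | rfl | omega

/-- What is at hand in the body of a loop with two running values `F` and `G`: these, the
loop counter (the second component), and all that was at hand outside. -/
def loopCtx (Γ : Set (E → ℕ)) (F G : E × ℕ → ℕ) : Set (E × ℕ → ℕ) :=
  insert F (insert G (insert Prod.snd ((fun g => g ∘ Prod.fst) '' Γ)))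

theorem loopCtx_comm (Γ : Set (E → ℕ)) (F G : E × ℕ → ℕ) : loopCtx Γ F G = loopCtx Γ G F :=
  Set.insert_comm _ _ _

/-- The arguments at which the body of a loop with `N e` rounds is evaluated. -/
def loopDom (D : Set E) (N : E → ℕ) : Set (E × ℕ) :=
  {x | x.1 ∈ D ∧ x.2 < N x.1}

set_option maxHeartbeats 1000000 in
/-- A loop: `F (e, i)` and `G (e, i)` are the running values after `i` rounds. The registers
`s, …, s + 4` hold `F`, `G`, the counter, the number of rounds, and the constant `1`. -/
theorem loop {N : E → ℕ} {F G : E × ℕ → ℕ} {B' : E → ℕ} (C : ℕ)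
    (hN : Comp D Γ N B) (hF₀ : Comp D Γ (fun e => F (e, 0)) B)
    (hG₀ : Comp D Γ (fun e => G (e, 0)) B)
    (hF : Comp (loopDom D N) (loopCtx Γ F G) (fun x => F (x.1, x.2 + 1)) (fun x => B' x.1))
    (hG : Comp (loopDom D N) (loopCtx Γ F G) (fun x => G (x.1, x.2 + 1)) (fun x => B' x.1))
    (hB : ∀ e ∈ D, N e * B' e ≤ C * B e) : Comp D Γ (fun e => F (e, N e)) B := by
  classical
  refine ⟨hN.1, fun ρ s b hρ => ?_⟩
  have up : ∀ i, ∀ g ∈ Γ, ρ g < s + i := fun i g hg => (hρ g hg).trans_le (by omega)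
  obtain ⟨c₁, K₁, t₁, hK₁, H₁⟩ := hF₀.2 ρ s b hρ
  obtain ⟨c₂, K₂, t₂, hK₂, H₂⟩ := hG₀.2 ρ (s + 1) (b + c₁.length) (up 1)
  obtain ⟨c₃, K₃, t₃, hK₃, H₃⟩ := hN.2 ρ (s + 3) (b + c₁.length + c₂.length) (up 3)
  set L := b + c₁.length + c₂.length + c₃.length + 2 with hL
  set ρ' : (E × ℕ → ℕ) → ℕ := fun h =>
    if h = F then s else if h = G then s + 1 else if h = Prod.snd then s + 2
    else ρ fun e => h (e, 0) with hρ'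
  have hρ'_lt : ∀ h ∈ loopCtx Γ F G, ρ' h < s + 3 := by
    intro h hh
    simp only [hρ']
    split_ifs with h1 h2 h3 <;> try omega
    obtain ⟨g, hg, rfl⟩ := ((hh.resolve_left h1).resolve_left h2).resolve_left h3
    exact up 3 g hg
  obtain ⟨c₄, K₄, t₄, hK₄, H₄⟩ := hF.2 ρ' (s + 5) (L + 1)
    fun h hh => (hρ'_lt h hh).trans (by omega)
  obtain ⟨c₅, K₅, t₅, hK₅, H₅⟩ := hG.2 ρ' (s + 6) (L + 1 + c₄.length)
    fun h hh => (hρ'_lt h hh).trans (by omega)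
  set K := max (max (max K₁ K₂) (max K₃ K₄)) K₅
  set L' := L + 1 + c₄.length + c₅.length with hL'
  refine ⟨c₁ ++ c₂ ++ c₃ ++ [Instr.const (s + 2) 0, Instr.const (s + 4) 1] ++
    [Instr.jumpLE (s + 3) (s + 2) (L' + 4)] ++ c₄ ++ c₅ ++
    [Instr.copy s (s + 5), Instr.copy (s + 1) (s + 6), Instr.add (s + 2) (s + 2) (s + 4),
      Instr.jump L], K, t₁ + t₂ + t₃ + 3 + C * (t₄ + t₅ + 5), by omega, fun P hP e he m hm => ?_⟩
  simp only [codeAt_append, codeAt_cons, List.length_append, List.length_cons,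
    List.length_nil, ← Nat.add_assoc, Nat.add_zero] at hP
  obtain ⟨⟨⟨⟨⟨⟨⟨hP₁, hP₂⟩, hP₃⟩, hi₁, hi₂, -⟩, hi₃, -⟩, hP₄⟩, hP₅⟩, hi₄, hi₅, hi₆, hi₇, -⟩ := hP
  obtain ⟨m₁, r₁, v₁, p₁⟩ := H₁ P hP₁ e he m hm
  obtain ⟨m₂, r₂, v₂, p₂⟩ := H₂ P hP₂ e he m₁ fun g hg => by rw [p₁ _ (hρ g hg), hm g hg]
  have p₂' : ∀ a < s, m₂ a = m a := fun a ha => by rw [p₂ a (by omega), p₁ a ha]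
  obtain ⟨m₃, r₃, v₃, p₃⟩ := H₃ P hP₃ e he m₂ fun g hg => by rw [p₂' _ (hρ g hg), hm g hg]
  have p₃' : ∀ a < s, m₃ a = m a := fun a ha => by rw [p₃ a (by omega), p₂' a ha]
  set m₀ := Function.update (Function.update m₃ (s + 2) 0) (s + 4) 1 with hm₀
  have inv : ∀ i ≤ N e, ∃ m', Reaches P K ⟨L, m₀⟩ ⟨L, m'⟩ (i * ((t₄ + t₅ + 5) * B' e)) ∧
      m' s = F (e, i) ∧ m' (s + 1) = G (e, i) ∧ m' (s + 2) = i ∧ m' (s + 3) = N e ∧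
      m' (s + 4) = 1 ∧ ∀ a < s, m' a = m a := by
    intro i
    induction i with
    | zero =>
      refine fun _ => ⟨m₀, by simpa using Reaches.refl P K _, ?_, ?_, ?_, ?_, ?_, fun a ha => ?_⟩
      · simp [hm₀, p₃ s (by omega), p₂ s (by omega), v₁]
      · simp [hm₀, p₃ (s + 1) (by omega), v₂]
      · simp [hm₀]
      · simp [hm₀, v₃]
      · simp [hm₀]
      · rw [hm₀, Function.update_of_ne (by omega), Function.update_of_ne (by omega), p₃' a ha]
    | succ i ih =>
      intro hi
      obtain ⟨m', r, u₀, u₁, u₂, u₃, u₄, p⟩ := ih (by omega)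
      have hx : (e, i) ∈ loopDom D N := ⟨he, hi⟩
      have hm' : ∀ h ∈ loopCtx Γ F G, m' (ρ' h) = h (e, i) := by
        intro h hh
        simp only [hρ']
        split_ifs with h1 h2 h3
        · rw [u₀, h1]
        · rw [u₁, h2]
        · rw [u₂, h3]
        · obtain ⟨g, hg, rfl⟩ := ((hh.resolve_left h1).resolve_left h2).resolve_left h3
          exact (p _ (hρ g hg)).trans (hm g hg)
      have rj := Reaches.jumpLE (K := K) (m := m') hi₃ (by omega) (by omega)
      rw [u₃, u₂, if_neg (by omega)] at rj
      obtain ⟨m₄, r₄, v₄, p₄⟩ := H₄ P hP₄ _ hx m' hm'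
      obtain ⟨m₅, r₅, v₅, p₅⟩ := H₅ P hP₅ _ hx m₄ fun h hh => by
        rw [p₄ _ ((hρ'_lt h hh).trans (by omega)), hm' h hh]
      have p₅' : ∀ a < s + 5, m₅ a = m' a := fun a ha => by rw [p₅ a (by omega), p₄ a ha]
      have w₁ : Reaches P K ⟨L', m₅⟩ ⟨L' + 1, Function.update m₅ s (F (e, i + 1))⟩ 1 := by
        refine Reaches.write hi₄ ?_ ?_ (by omega)
        · simp [Instr.exec, Config.write, p₅ (s + 5) (by omega), v₄]
        · simp [Instr.touched]; omega
      set m₆ := Function.update m₅ s (F (e, i + 1)) with hm₆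
      have w₂ : Reaches P K ⟨L' + 1, m₆⟩
          ⟨L' + 1 + 1, Function.update m₆ (s + 1) (G (e, i + 1))⟩ 1 := by
        refine Reaches.write hi₅ ?_ ?_ (by omega)
        · simp [Instr.exec, Config.write, hm₆, v₅]
        · simp [Instr.touched]; omega
      set m₇ := Function.update m₆ (s + 1) (G (e, i + 1)) with hm₇
      have w₃ : Reaches P K ⟨L' + 1 + 1, m₇⟩
          ⟨L' + 1 + 1 + 1, Function.update m₇ (s + 2) (i + 1)⟩ 1 := by
        refine Reaches.write hi₆ ?_ ?_ (by omega)
        · simp [Instr.exec, Config.write, hm₇, hm₆, p₅' (s + 2) (by omega),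
            p₅' (s + 4) (by omega), u₂, u₄]
        · simp [Instr.touched]; omega
      set m₈ := Function.update m₇ (s + 2) (i + 1) with hm₈
      have w₄ : Reaches P K ⟨L' + 1 + 1 + 1, m₈⟩ ⟨L, m₈⟩ 1 := Reaches.jump hi₇
      refine ⟨m₈, ?_, ?_, ?_, ?_, ?_, ?_, fun a ha => ?_⟩
      · have r₄' := r₄.mono (show K₄ ≤ K by omega) le_rfl
        have r₅' := r₅.mono (show K₅ ≤ K by omega) le_rfl
        refine (((((((r.trans rj).trans r₄').trans r₅').trans w₁).trans w₂).trans w₃).trans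
          w₄).mono le_rfl ?_
        have := hF.1 _ hx
        simp only at this ⊢
        nlinarith
      · simp [hm₈, hm₇, hm₆]
      · simp [hm₈, hm₇]
      · simp [hm₈]
      · simp [hm₈, hm₇, hm₆, p₅' (s + 3) (by omega), u₃]
      · simp [hm₈, hm₇, hm₆, p₅' (s + 4) (by omega), u₄]
      · rw [hm₈, Function.update_of_ne (by omega), hm₇, Function.update_of_ne (by omega), hm₆,
          Function.update_of_ne (by omega), p₅' a (by omega), p a ha]
  obtain ⟨m', r, u₀, -, u₂, u₃, -, p⟩ := inv (N e) le_rfl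
  refine ⟨m', ?_, u₀, p⟩
  have r₁' := r₁.mono (show K₁ ≤ K by omega) le_rfl
  have r₂' := r₂.mono (show K₂ ≤ K by omega) le_rfl
  have r₃' := r₃.mono (show K₃ ≤ K by omega) le_rfl
  have w₁ : Reaches P K ⟨b + c₁.length + c₂.length + c₃.length, m₃⟩
      ⟨b + c₁.length + c₂.length + c₃.length + 1, Function.update m₃ (s + 2) 0⟩ 1 := by
    refine Reaches.write hi₁ ?_ ?_ (by omega)
    · simp [Instr.exec, Config.write]
    · simp [Instr.touched]; omega
  have w₂ : Reaches P K ⟨b + c₁.length + c₂.length + c₃.length + 1,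
      Function.update m₃ (s + 2) 0⟩ ⟨L, m₀⟩ 1 := by
    refine Reaches.write hi₂ ?_ ?_ (by omega)
    · simp [Instr.exec, Config.write]
    · simp [Instr.touched]; omega
  have rj := Reaches.jumpLE (K := K) (m := m') hi₃ (by omega) (by omega)
  rw [u₃, u₂, if_pos le_rfl] at rj
  have hend : b + (c₁ ++ c₂ ++ c₃ ++ [Instr.const (s + 2) 0, Instr.const (s + 4) 1] ++
      [Instr.jumpLE (s + 3) (s + 2) (L' + 4)] ++ c₄ ++ c₅ ++
      [Instr.copy s (s + 5), Instr.copy (s + 1) (s + 6), Instr.add (s + 2) (s + 2) (s + 4),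
      Instr.jump L]).length = L' + 4 := by
    simp only [List.length_append, List.length_cons, List.length_nil]
    omega
  rw [hend]
  refine ((((((r₁'.trans r₂').trans r₃').trans w₁).trans w₂).trans r).trans rj).mono le_rfl ?_
  have h1 := hN.1 e he
  have h2 := Nat.mul_le_mul_left (t₄ + t₅ + 5) (hB e he)
  have h3 : N e * ((t₄ + t₅ + 5) * B' e) = (t₄ + t₅ + 5) * (N e * B' e) := by ring
  have h4 : (t₄ + t₅ + 5) * (C * B e) = C * (t₄ + t₅ + 5) * B e := by ring
  rw [h3]
  nlinarith

/-- A loop with a single running value. -/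
theorem loop_one {N : E → ℕ} {F : E × ℕ → ℕ} {B' : E → ℕ} (C : ℕ)
    (hN : Comp D Γ N B) (hF₀ : Comp D Γ (fun e => F (e, 0)) B)
    (hF : Comp (loopDom D N) (loopCtx Γ F F) (fun x => F (x.1, x.2 + 1)) (fun x => B' x.1))
    (hB : ∀ e ∈ D, N e * B' e ≤ C * B e) : Comp D Γ (fun e => F (e, N e)) B :=
  loop C hN hF₀ hF₀ hF hF hB

theorem loopCtx_counter {F G : E × ℕ → ℕ} : Prod.snd ∈ loopCtx Γ F G := by
  simp [loopCtx]

theorem loopCtx_fst {F G : E × ℕ → ℕ} : F ∈ loopCtx Γ F G := by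
  simp [loopCtx]

theorem loopCtx_snd {F G : E × ℕ → ℕ} : G ∈ loopCtx Γ F G := by
  simp [loopCtx]

theorem loopCtx_outer {F G : E × ℕ → ℕ} (hg : g ∈ Γ) :
    (fun x => g x.1) ∈ loopCtx Γ F G :=
  Or.inr (Or.inr (Or.inr ⟨g, hg, rfl⟩))

/-- Powers, by repeated multiplication. -/
theorem pow (C : ℕ) (hf : Comp D Γ f B) (hg : Comp D Γ g B) (h : ∀ e ∈ D, g e ≤ C * B e) :
    Comp D Γ (fun e => f e ^ g e) B := by
  have hB := hf.1
  refine hf.keep (loop_one (F := fun x => f x.1 ^ x.2) (B' := fun _ => 1) C ?_ ?_ ?_ ?_)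
  · exact hg.weaken (Set.subset_insert _ _)
  · exact (const hB 1).congr fun _ _ => by simp
  · exact (mul (var (by simp) loopCtx_fst)
      (var (by simp) (loopCtx_outer (Set.mem_insert _ _)))).congr fun x _ => by simp [pow_succ]
  · simpa using h

/-- Sums, by repeated addition. -/
theorem sum {N : E → ℕ} {F : E × ℕ → ℕ} {B' : E → ℕ} (C : ℕ) (hN : Comp D Γ N B)
    (hF : Comp (loopDom D N) (insert Prod.snd ((fun g => g ∘ Prod.fst) '' Γ)) F
      (fun x => B' x.1))
    (hB : ∀ e ∈ D, N e * B' e ≤ C * B e) :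
    Comp D Γ (fun e => ∑ i ∈ Finset.range (N e), F (e, i)) B := by
  refine loop_one (F := fun x => ∑ i ∈ Finset.range x.2, F (x.1, i)) (B' := B') C hN
    ((const hN.1 0).congr fun _ _ => by simp) ?_ hB
  exact (add (var hF.1 loopCtx_fst) (hF.weaken
    ((Set.subset_insert _ _).trans (Set.subset_insert _ _)))).congr
    fun x _ => by simp [Finset.sum_range_succ]

end Comp

end RAM

/-! ### Borders of numbers -/

/-- The word of length `n` whose letters are the base-`k` digits of `x`, most significant digit
first, has a border; `i` is the length of the border. -/
def Brd (k n x : ℕ) : Prop :=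
  ∃ i ∈ Finset.Ico 1 n, x / k ^ (n - i) = x % k ^ i

instance (k n : ℕ) : DecidablePred (Brd k n) := fun _ =>
  inferInstanceAs (Decidable (∃ i ∈ Finset.Ico 1 n, _ = _))

/-- The number `i` is the length of the shortest border of the word of length `n` with digits
`x`. As a border of a border is a border, this means that the border is itself unbordered. -/
def ShortestBorder (k n x i : ℕ) : Prop :=
  1 ≤ i ∧ 2 * i ≤ n ∧ x / k ^ (n - i) = x % k ^ i ∧ ¬ Brd k i (x / k ^ (n - i))

instance (k n x i : ℕ) : Decidable (ShortestBorder k n x i) :=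
  inferInstanceAs (Decidable (_ ∧ _ ∧ _ ∧ _))

/-- For borders of lengths `l < i` of a word, the first is one of the second, and conversely. -/
theorem border_border {k n x i l : ℕ} (hi : x / k ^ (n - i) = x % k ^ i) (hin : i ≤ n)
    (hl : l ≤ i) :
    x / k ^ (n - i) / k ^ (i - l) = x / k ^ (n - i) % k ^ l ↔
      x / k ^ (n - l) = x % k ^ l := by
  rw [Nat.div_div_eq_div_mul, ← pow_add, show n - i + (i - l) = n - l by omega, hi,
    Nat.mod_mod_of_dvd _ (pow_dvd_pow k hl)]

/-- A border longer than half of the word overlaps itself in a shorter border. -/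
theorem border_overlap {k n x i : ℕ} (hi : x / k ^ (n - i) = x % k ^ i) (hin : i ≤ n)
    (h : n ≤ 2 * i) : x / k ^ (n - (2 * i - n)) = x % k ^ (2 * i - n) := by
  have h1 : k ^ i = k ^ (n - i) * k ^ (2 * i - n) := by
    rw [← pow_add]; congr 1; omega
  have h2 : x % k ^ i / k ^ (n - i) = x / k ^ (n - i) % k ^ (2 * i - n) := by
    rw [h1, Nat.mod_mul_right_div_self]
  rw [show n - (2 * i - n) = (n - i) + (n - i) by omega, pow_add, ← Nat.div_div_eq_div_mul, hi, h2,
    hi, Nat.mod_mod_of_dvd _ (pow_dvd_pow k (by omega))]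

theorem Brd.exists_shortestBorder {k n x : ℕ} (h : Brd k n x) :
    ∃ i, ShortestBorder k n x i := by
  have h' : ∃ i, i ∈ Finset.Ico 1 n ∧ x / k ^ (n - i) = x % k ^ i := h
  obtain ⟨hi, hb⟩ := Nat.find_spec h'
  have hmin : ∀ {l}, l < Nat.find h' → _ := fun hl => Nat.find_min h' hl
  set i := Nat.find h'
  rw [Finset.mem_Ico] at hi
  refine ⟨i, hi.1, ?_, hb, ?_⟩
  · by_contra! hlt
    refine hmin (l := 2 * i - n) (by omega) ⟨Finset.mem_Ico.2 ⟨by omega, by omega⟩, ?_⟩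
    exact border_overlap hb hi.2.le hlt.le
  · rintro ⟨l, hl, hlb⟩
    rw [Finset.mem_Ico] at hl
    exact hmin hl.2 ⟨Finset.mem_Ico.2 ⟨hl.1, by omega⟩,
      (border_border hb hi.2.le hl.2.le).1 hlb⟩

theorem ShortestBorder.brd {k n x i : ℕ} (h : ShortestBorder k n x i) : Brd k n x :=
  ⟨i, Finset.mem_Ico.2 ⟨h.1, by have := h.1; have := h.2.1; omega⟩, h.2.2.1⟩

theorem ShortestBorder.not_lt {k n x i l : ℕ} (h : ShortestBorder k n x i)
    (h' : ShortestBorder k n x l) : ¬ l < i := fun hl =>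
  h.2.2.2 ⟨l, Finset.mem_Ico.2 ⟨h'.1, hl⟩,
    (border_border h.2.2.1 (by have := h.2.1; omega) hl.le).2 h'.2.2.1⟩

theorem ShortestBorder.unique {k n x i l : ℕ} (h : ShortestBorder k n x i)
    (h' : ShortestBorder k n x l) : i = l := by
  have := h.not_lt h'
  have := h'.not_lt h
  omega

/-! ### Counting unbordered words with a given prefix -/

/-- The word of length `j` with digits `x` and the word of length `m` with digits `p` are
comparable: one is a prefix of the other. Truncated subtraction makes one of the two divisors
equal to `1`. -/
def Compat (k p m j x : ℕ) : Prop :=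
  x / k ^ (j - m) = p / k ^ (m - j)

instance (k p m j x : ℕ) : Decidable (Compat k p m j x) :=
  inferInstanceAs (Decidable (_ = _))

/-- The number of unbordered words of length `j` over `k` letters that are comparable to the
word `p` of length `m`. -/
def unbordered (k p m j : ℕ) : ℕ :=
  ((Finset.range (k ^ j)).filter fun x => Compat k p m j x ∧ ¬ Brd k j x).card

/-- The number of words of length `j` comparable to the word `p` of length `m` with a given
border of length `i ≤ j / 2` that is comparable to `p`. -/
def completions (k p m i j : ℕ) : ℕ :=
  if p / k ^ (m - j) % k ^ (i - (j - m)) = p / k ^ (m - i) / k ^ (j - m) then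
    k ^ (j - (m + (i - m)) - i)
  else 0

/-- The numbers with given quotient by `a` and given remainder by a divisor `b` of `a`. -/
theorem card_filter_div_mod {M a b c d e : ℕ} (ha : a = b * e) (hd : d < b) (he : 0 < e)
    (hM : (c + 1) * a ≤ M) :
    ((Finset.range M).filter fun x => x / a = c ∧ x % b = d).card = e := by
  have hb : 0 < b := by omega
  have : ((Finset.range M).filter fun x => x / a = c ∧ x % b = d) =
      (Finset.range e).image fun v => c * a + v * b + d := by
    ext x
    simp only [Finset.mem_filter, Finset.mem_range, Finset.mem_image]
    constructor
    · rintro ⟨-, h1, h2⟩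
      have e1 := Nat.div_add_mod x a
      have e2 := Nat.div_add_mod (x % a) b
      have e3 : x % a % b = d := by rw [Nat.mod_mod_of_dvd _ ⟨e, ha⟩, h2]
      refine ⟨x % a / b, ?_, ?_⟩
      · rw [Nat.div_lt_iff_lt_mul hb, mul_comm, ← ha]
        exact Nat.mod_lt _ (by rw [ha]; positivity)
      · rw [e3] at e2
        rw [h1] at e1
        nlinarith
    · rintro ⟨v, hv, rfl⟩
      have h1 : v * b + d < a := by
        rw [ha]; nlinarith
      refine ⟨by nlinarith, ?_, ?_⟩
      · rw [show c * a + v * b + d = a * c + (v * b + d) by ring, Nat.mul_add_div (by omega),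
          Nat.div_eq_of_lt h1, add_zero]
      · rw [ha, show c * (b * e) + v * b + d = b * (c * e + v) + d by ring, Nat.mul_add_mod,
          Nat.mod_eq_of_lt hd]
  rw [this, Finset.card_image_of_injective, Finset.card_range]
  intro v w h
  simpa [hb.ne'] using h


/-- The interval of the words of length `j` comparable to `p` lies below `k ^ j`. -/
theorem prefix_succ_mul_le {k p m j : ℕ} (hp : p < k ^ m) :
    (p / k ^ (m - j) + 1) * k ^ (j - m) ≤ k ^ j := by
  have h : p / k ^ (m - j) < k ^ (j - (j - m)) := by
    apply Nat.div_lt_of_lt_mul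
    rwa [← pow_add, show m - j + (j - (j - m)) = m by omega]
  calc _ ≤ k ^ (j - (j - m)) * k ^ (j - m) := Nat.mul_le_mul_right _ h
    _ = k ^ j := by rw [← pow_add]; congr 1; omega

theorem card_compat {k p m j : ℕ} (hk : 0 < k) (hp : p < k ^ m) :
    ((Finset.range (k ^ j)).filter (Compat k p m j)).card = k ^ (j - m) := by
  rw [← card_filter_div_mod (one_mul _).symm one_pos (pow_pos hk _) (prefix_succ_mul_le hp)]
  simp [Compat, Nat.mod_one]
  rfl

theorem Compat.take {k p m i j x : ℕ} (hij : i ≤ j) (h : Compat k p m j x) :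
    Compat k p m i (x / k ^ (j - i)) := by
  unfold Compat at *
  rw [Nat.div_div_eq_div_mul, ← pow_add]
  have e1 : j - i + (i - m) = (j - m) + (m - i - (m - j)) := by omega
  rw [e1, pow_add, ← Nat.div_div_eq_div_mul, h, Nat.div_div_eq_div_mul, ← pow_add]
  congr 2
  omega

/-- The number of words comparable to `p` with a given border `u` comparable to `p`. -/
theorem card_border_eq {k p m i j u : ℕ} (hk : 0 < k) (hp : p < k ^ m) (hij : 2 * i ≤ j)
    (hu : u < k ^ i) (hup : Compat k p m i u) :
    ((Finset.range (k ^ j)).filter fun x =>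
      Compat k p m j x ∧ x / k ^ (j - i) = u ∧ x % k ^ i = u).card = completions k p m i j := by
  rcases le_total m i with hmi | hmi
  · -- the border determines whether the word is comparable to `p`
    have hpu : u / k ^ (i - m) = p := by simpa [Compat, hmi] using hup
    have h0 : p / k ^ (j - m) = 0 :=
      Nat.div_eq_of_lt (hp.trans_le (Nat.pow_le_pow_right hk (by omega)))
    have : completions k p m i j = k ^ (j - 2 * i) := by
      unfold completions
      rw [show m - j = 0 by omega, show i - (j - m) = 0 by omega, show m - i = 0 by omega,
        pow_zero, Nat.mod_one, Nat.div_one, h0, if_pos rfl]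
      congr 1
      omega
    rw [this]
    refine Eq.trans ?_ (card_filter_div_mod (M := k ^ j) (a := k ^ (j - i)) (c := u) ?_ hu
      (pow_pos hk _) ?_)
    · congr 1
      refine Finset.filter_congr fun x _ => ⟨fun h => h.2, fun h => ⟨?_, h⟩⟩
      rw [Compat, show m - j = 0 by omega, pow_zero, Nat.div_one, ← hpu, ← h.1,
        Nat.div_div_eq_div_mul, ← pow_add]
      congr 2
      omega
    · rw [← pow_add]; congr 1; omega
    · calc _ ≤ k ^ i * k ^ (j - i) := Nat.mul_le_mul_right _ hu
        _ = k ^ j := by rw [← pow_add]; congr 1; omega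
  · -- the border is a prefix of `p`
    have hpu : p / k ^ (m - i) = u := by
      have : u / k ^ (i - m) = p / k ^ (m - i) := hup
      rw [← this, show i - m = 0 by omega, pow_zero, Nat.div_one]
    have hfil : ((Finset.range (k ^ j)).filter fun x =>
        Compat k p m j x ∧ x / k ^ (j - i) = u ∧ x % k ^ i = u) =
        (Finset.range (k ^ j)).filter fun x => x / k ^ (j - m) = p / k ^ (m - j) ∧
          x % k ^ i = u := by
      refine Finset.filter_congr fun x _ => ⟨fun h => ⟨h.1, h.2.2⟩, fun h => ⟨h.1, ?_, h.2⟩⟩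
      have := Compat.take (i := i) (by omega) (show Compat k p m j x from h.1)
      rwa [Compat, show i - m = 0 by omega, pow_zero, Nat.div_one, hpu] at this
    rw [hfil, completions, hpu]
    rcases le_or_gt i (j - m) with him | him
    · -- the two occurrences of the border and `p` leave a gap
      have h0 : u / k ^ (j - m) = 0 :=
        Nat.div_eq_of_lt (hu.trans_le (Nat.pow_le_pow_right hk him))
      rw [show i - (j - m) = 0 by omega, pow_zero, Nat.mod_one, h0, if_pos rfl]
      apply card_filter_div_mod _ hu (pow_pos hk _) (prefix_succ_mul_le hp)
      rw [← pow_add]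
      congr 1
      omega
    · -- the last occurrence of the border overlaps `p`, so there is at most one word
      set q := p / k ^ (m - j)
      have hK : 0 < k ^ (j - m) := pow_pos hk _
      have hsplit : k ^ i = k ^ (j - m) * k ^ (i - (j - m)) := by
        rw [← pow_add]; congr 1; omega
      rw [show j - (m + (i - m)) - i = 0 by omega, pow_zero]
      have key : ∀ x, x / k ^ (j - m) = q ∧ x % k ^ i = u ↔
          (x / k ^ (j - m) = q ∧ x % k ^ (j - m) = u % k ^ (j - m)) ∧
            q % k ^ (i - (j - m)) = u / k ^ (j - m) := by
        intro x
        have e1 : x % k ^ i / k ^ (j - m) = x / k ^ (j - m) % k ^ (i - (j - m)) := by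
          rw [hsplit, Nat.mod_mul_right_div_self]
        have e2 : x % k ^ i % k ^ (j - m) = x % k ^ (j - m) := by
          rw [hsplit, Nat.mod_mul_right_mod]
        constructor
        · rintro ⟨h1, h2⟩
          rw [h1, h2] at e1
          rw [h2] at e2
          exact ⟨⟨h1, e2.symm⟩, e1.symm⟩
        · rintro ⟨⟨h1, h2⟩, h3⟩
          refine ⟨h1, ?_⟩
          rw [← Nat.div_add_mod (x % k ^ i) (k ^ (j - m)), e1, e2, h1, h2, h3, Nat.div_add_mod]
      split_ifs with hc
      · rw [← card_filter_div_mod (mul_one (k ^ (j - m))).symm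
          (Nat.mod_lt u hK) one_pos (prefix_succ_mul_le hp)]
        congr 1
        exact Finset.filter_congr fun x _ => by rw [key]; simp [hc, q]
      · rw [Finset.card_eq_zero, Finset.filter_eq_empty_iff]
        intro x _ h
        exact hc ((key x).1 h).2

/-- The words with shortest border of length `i`: the border is an unbordered word comparable to
`p`, and the number of words with that border does not depend on it. -/
theorem card_shortestBorder {k p m i j : ℕ} (hk : 0 < k) (hp : p < k ^ m) (hi : 1 ≤ i)
    (hij : 2 * i ≤ j) :
    ((Finset.range (k ^ j)).filter fun x => Compat k p m j x ∧ ShortestBorder k j x i).card =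
      unbordered k p m i * completions k p m i j := by
  rw [unbordered, Finset.card_eq_sum_card_fiberwise (f := fun x => x / k ^ (j - i))
    (t := (Finset.range (k ^ i)).filter fun x => Compat k p m i x ∧ ¬ Brd k i x)]
  · rw [Finset.sum_const_nat]
    intro u hu
    simp only [Finset.mem_filter, Finset.mem_range] at hu
    rw [← card_border_eq hk hp hij hu.1 hu.2.1, Finset.filter_filter]
    congr 1
    refine Finset.filter_congr fun x _ => ⟨?_, ?_⟩
    · rintro ⟨⟨h1, h2⟩, h3⟩
      exact ⟨h1, h3, by rw [← h2.2.2.1, h3]⟩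
    · rintro ⟨h1, h2, h3⟩
      exact ⟨⟨h1, hi, hij, by rw [h2, h3], by rw [h2]; exact hu.2.2⟩, h2⟩
  · intro x hx
    simp only [Finset.coe_filter, Set.mem_ofPred_eq, Finset.mem_range] at hx ⊢
    refine ⟨?_, hx.2.1.take (by omega), hx.2.2.2.2.2⟩
    apply Nat.div_lt_of_lt_mul
    rw [← pow_add, show j - i + i = j by omega]
    exact hx.1

/-- The recurrence for the number of unbordered words: all other words are classified by the
length `i + 1` of their shortest border. -/
theorem unbordered_add_sum {k p m : ℕ} (hk : 0 < k) (hp : p < k ^ m) (j : ℕ) :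
    unbordered k p m j + ∑ i ∈ Finset.range (j / 2),
      unbordered k p m (i + 1) * completions k p m (i + 1) j = k ^ (j - m) := by
  have hsum : ∑ i ∈ Finset.range (j / 2),
      unbordered k p m (i + 1) * completions k p m (i + 1) j =
      ((Finset.range (k ^ j)).filter fun x => Compat k p m j x ∧ Brd k j x).card := by
    have hU : ((Finset.range (k ^ j)).filter fun x => Compat k p m j x ∧ Brd k j x) =
        (Finset.range (j / 2)).biUnion fun i => (Finset.range (k ^ j)).filter fun x =>
          Compat k p m j x ∧ ShortestBorder k j x (i + 1) := by
      ext x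
      simp only [Finset.mem_filter, Finset.mem_biUnion, Finset.mem_range]
      constructor
      · rintro ⟨h1, h2, h3⟩
        obtain ⟨i, hi⟩ := h3.exists_shortestBorder
        have := hi.1
        have := hi.2.1
        exact ⟨i - 1, by omega, h1, h2, by rwa [Nat.sub_add_cancel hi.1]⟩
      · rintro ⟨i, -, h1, h2, h3⟩
        exact ⟨h1, h2, h3.brd⟩
    rw [hU, Finset.card_biUnion]
    · refine Finset.sum_congr rfl fun i hi => ?_
      rw [Finset.mem_range] at hi
      rw [card_shortestBorder hk hp (by omega) (by omega)]
    · intro a _ b _ hab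
      rw [Function.onFun, Finset.disjoint_filter]
      rintro x _ h1 h2
      exact hab (Nat.succ_injective (h1.2.unique h2.2))
  rw [hsum, unbordered, ← card_compat hk hp (j := j), add_comm, ← Finset.filter_filter,
    ← Finset.filter_filter, Finset.card_filter_add_card_filter_not]

theorem unbordered_le {k p m : ℕ} (hk : 0 < k) (hp : p < k ^ m) (j : ℕ) :
    unbordered k p m j ≤ k ^ (j - m) := by
  have := unbordered_add_sum hk hp j
  omega

/-- The bordered words of length `n` with prefix `p` occupy an interval of numbers. -/
theorem count_brd_prefix {k p m n : ℕ} (hk : 0 < k) (hp : p < k ^ m) (hmn : m ≤ n) :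
    Nat.count (Brd k n) ((p + 1) * k ^ (n - m)) =
      Nat.count (Brd k n) (p * k ^ (n - m)) + (k ^ (n - m) - unbordered k p m n) := by
  have hK : 0 < k ^ (n - m) := pow_pos hk _
  have hle : (p + 1) * k ^ (n - m) ≤ k ^ n := by
    calc _ ≤ k ^ m * k ^ (n - m) := Nat.mul_le_mul_right _ hp
      _ = k ^ n := by rw [← pow_add]; congr 1; omega
  have h1 : k ^ (n - m) - unbordered k p m n =
      ((Finset.range (k ^ n)).filter fun x => Compat k p m n x ∧ Brd k n x).card := by
    rw [unbordered, ← card_compat hk hp (j := n), ← Finset.filter_filter, ← Finset.filter_filter,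
      ← Finset.card_filter_add_card_filter_not (s := (Finset.range (k ^ n)).filter _) (Brd k n),
      Nat.add_sub_cancel]
  rw [h1, Nat.count_eq_card_filter_range, Nat.count_eq_card_filter_range,
    ← Finset.card_union_of_disjoint]
  · congr 1
    ext x
    simp only [Finset.mem_filter, Finset.mem_range, Finset.mem_union, Compat,
      show m - n = 0 by omega, pow_zero, Nat.div_one]
    have h2 : x / k ^ (n - m) = p ↔ p * k ^ (n - m) ≤ x ∧ x < (p + 1) * k ^ (n - m) := by
      rw [← Nat.le_div_iff_mul_le hK, ← Nat.div_lt_iff_lt_mul hK]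
      omega
    rw [h2]
    constructor
    · rintro ⟨h3, h4⟩
      rcases lt_or_ge x (p * k ^ (n - m)) with h5 | h5
      · exact Or.inl ⟨h5, h4⟩
      · exact Or.inr ⟨by omega, ⟨h5, h3⟩, h4⟩
    · rintro (⟨h3, h4⟩ | ⟨h3, h4, h5⟩)
      · exact ⟨h3.trans_le (Nat.mul_le_mul_right _ (by omega)), h4⟩
      · exact ⟨h4.2, h5⟩
  · rw [Finset.disjoint_left]
    simp only [Finset.mem_filter, Finset.mem_range, Compat, show m - n = 0 by omega, pow_zero,
      Nat.div_one]
    rintro x ⟨h2, -⟩ ⟨-, h3, -⟩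
    rw [← Nat.div_lt_iff_lt_mul hK] at h2
    omega

/-! ### Tables packed into one number -/

/-- The values `v 0, …, v (j - 1)` as the digits of a number in base `R`. -/
def packed (R : ℕ) (v : ℕ → ℕ) (j : ℕ) : ℕ :=
  ∑ l ∈ Finset.range j, v l * R ^ l

theorem packed_lt {R : ℕ} {v : ℕ → ℕ} {j : ℕ} (h : ∀ l < j, v l < R) : packed R v j < R ^ j := by
  induction j with
  | zero => simp [packed]
  | succ j ih =>
    have h1 : packed R v (j + 1) = packed R v j + v j * R ^ j := Finset.sum_range_succ _ _
    have h2 := ih fun l hl => h l (by omega)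
    have h3 : (v j + 1) * R ^ j ≤ R * R ^ j := Nat.mul_le_mul_right _ (h j (by omega))
    rw [h1, pow_succ]
    nlinarith

theorem packed_digit {R : ℕ} {v : ℕ → ℕ} {j i : ℕ} (h : ∀ l < j, v l < R) (hi : i < j) :
    packed R v j / R ^ i % R = v i := by
  induction j with
  | zero => omega
  | succ j ih =>
    have h1 : packed R v (j + 1) = packed R v j + v j * R ^ j := Finset.sum_range_succ _ _
    have hR : 0 < R := by have := h i hi; omega
    rcases Nat.lt_succ_iff_lt_or_eq.1 hi with hij | rfl
    · obtain ⟨d, rfl⟩ := Nat.exists_eq_add_of_lt hij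
      rw [h1, show v (i + d + 1) * R ^ (i + d + 1) = R ^ i * (R * (v (i + d + 1) * R ^ d)) by ring,
        Nat.add_mul_div_left _ _ (pow_pos hR _), Nat.add_mul_mod_self_left]
      exact ih (fun l hl => h l (by omega)) hij
    · rw [h1, Nat.add_mul_div_right _ _ (pow_pos hR _),
        Nat.div_eq_of_lt (packed_lt fun l hl => h l (by omega)), zero_add,
        Nat.mod_eq_of_lt (h _ hi)]

/-! ### The program for the number of unbordered words -/

namespace RAM.Comp

variable {E : Type*} {D : Set E} {Γ : Set (E → ℕ)} {k p m i j n N : E → ℕ}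

theorem completions (hk : Comp D Γ k N) (hp : Comp D Γ p N) (hm : Comp D Γ m N)
    (hi : Comp D Γ i N) (hj : Comp D Γ j N) (hmN : ∀ e ∈ D, m e ≤ N e) (hiN : ∀ e ∈ D, i e ≤ N e)
    (hjN : ∀ e ∈ D, j e ≤ N e) :
    Comp D Γ (fun e => _root_.completions (k e) (p e) (m e) (i e) (j e)) N := by
  refine ite_eq
    ((hp.div (hk.pow 1 (hm.sub hj) ?_)).mod (hk.pow 1 (hi.sub (hj.sub hm)) ?_))
    ((hp.div (hk.pow 1 (hm.sub hi) ?_)).div (hk.pow 1 (hj.sub hm) ?_))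
    (hk.pow 1 ((hj.sub (hm.add (hi.sub hm))).sub hi) ?_) (const hk.1 0)
  all_goals
    intro e he
    have := hmN e he
    have := hiN e he
    have := hjN e he
    omega

/-- One step of the recurrence for the number of unbordered words. -/
theorem unbordered_step {R T : E → ℕ} (hk : k ∈ Γ) (hp : p ∈ Γ) (hm : m ∈ Γ) (hj : j ∈ Γ)
    (hR : R ∈ Γ) (hT : T ∈ Γ) (hN : ∀ e ∈ D, 1 ≤ N e)
    (hmN : ∀ e ∈ D, m e ≤ N e) (hjN : ∀ e ∈ D, j e ≤ N e)
    (hk₀ : ∀ e ∈ D, 0 < k e) (hp₀ : ∀ e ∈ D, p e < k e ^ m e)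
    (hR₀ : ∀ e ∈ D, ∀ l < j e, unbordered (k e) (p e) (m e) l < R e)
    (hT₀ : ∀ e ∈ D, T e = packed (R e) (unbordered (k e) (p e) (m e)) (j e)) :
    Comp D Γ (fun e => unbordered (k e) (p e) (m e) (j e)) (fun e => N e ^ 2) := by
  have hN2 : ∀ e ∈ D, 1 ≤ N e ^ 2 := fun e he => Nat.one_le_pow _ _ (hN e he)
  have tot : Comp D Γ (fun e => k e ^ (j e - m e)) (fun e => N e ^ 2) := by
    refine pow 1 (var hN2 hk) ((var hN2 hj).sub (var hN2 hm)) fun e he => ?_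
    have := hjN e he
    have := hN e he
    nlinarith [Nat.sub_le (j e) (m e)]
  have term : Comp (loopDom D fun e => j e / 2) (insert Prod.snd ((fun g => g ∘ Prod.fst) '' Γ))
      (fun x => (T x.1 / R x.1 ^ (x.2 + 1) % R x.1) *
        _root_.completions (k x.1) (p x.1) (m x.1) (x.2 + 1) (j x.1)) (fun x => N x.1) := by
    have hB : ∀ x ∈ loopDom D fun e => j e / 2, 1 ≤ N x.1 := fun x hx => hN _ hx.1
    have v : ∀ g ∈ Γ, Comp (loopDom D fun e => j e / 2)
        (insert Prod.snd ((fun g => g ∘ Prod.fst) '' Γ)) (fun x => g x.1) (fun x => N x.1) :=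
      fun g hg => var hB (Or.inr ⟨g, hg, rfl⟩)
    have c : Comp (loopDom D fun e => j e / 2)
        (insert Prod.snd ((fun g => g ∘ Prod.fst) '' Γ)) (fun x => x.2 + 1) (fun x => N x.1) :=
      (var hB (Or.inl rfl)).add (const hB 1)
    have hx : ∀ x ∈ loopDom D fun e => j e / 2, x.2 + 1 ≤ N x.1 := by
      rintro x ⟨h1, h2⟩
      have := hjN _ h1
      have : x.2 < j x.1 / 2 := h2
      omega
    -- the entry `i + 1` of the table is a digit of `T`
    refine (((v T hT).div ((v R hR).pow 1 c fun x h => ?_)).mod (v R hR)).mul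
      (completions (v k hk) (v p hp) (v m hm) c (v j hj) (fun x h => hmN _ h.1) hx
        fun x h => hjN _ h.1)
    rw [one_mul]
    exact hx x h
  have s := sum (N := fun e => j e / 2) (B := fun e => N e ^ 2) (B' := N) 1
    ((var hN2 hj).div (const hN2 2)) term fun e he => by
      have := hjN e he
      have : j e / 2 ≤ N e := by omega
      rw [one_mul, sq]
      exact Nat.mul_le_mul_right _ this
  refine (tot.sub s).congr fun e he => ?_
  rw [← unbordered_add_sum (hk₀ e he) (hp₀ e he) (j e)]
  have : ∀ l ∈ Finset.range (j e / 2), (T e / R e ^ (l + 1) % R e) *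
      _root_.completions (k e) (p e) (m e) (l + 1) (j e) =
      unbordered (k e) (p e) (m e) (l + 1) *
        _root_.completions (k e) (p e) (m e) (l + 1) (j e) := by
    intro l hl
    rw [Finset.mem_range] at hl
    rw [hT₀ e he, packed_digit (hR₀ e he) (by omega)]
  rw [Finset.sum_congr rfl this, Nat.add_sub_cancel]

/-- The number of unbordered words with a given prefix is computed in cubic time, by tabulating
the recurrence. The base of the packed table exceeds all of its entries. -/
theorem unbordered (hk : k ∈ Γ) (hp : p ∈ Γ) (hm : m ∈ Γ) (hn : n ∈ Γ)
    (hk₀ : ∀ e ∈ D, 0 < k e) (hp₀ : ∀ e ∈ D, p e < k e ^ m e) (hmn : ∀ e ∈ D, m e ≤ n e) :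
    Comp D Γ (fun e => _root_.unbordered (k e) (p e) (m e) (n e)) (fun e => (n e + 1) ^ 3) := by
  have h1 : ∀ a e, 1 ≤ (n e + 1) ^ a := fun a e => Nat.one_le_pow _ _ (by omega)
  set R : E → ℕ := fun e => k e ^ n e + 1
  have hR : Comp D Γ R (fun e => (n e + 1) ^ 3) := by
    refine (pow 1 (var (fun e _ => h1 3 e) hk) (var (fun e _ => h1 3 e) hn) fun e _ => ?_).add
      (const (fun e _ => h1 3 e) 1)
    nlinarith [Nat.le_self_pow (show 3 ≠ 0 by norm_num) (n e + 1)]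
  have hRlt : ∀ e ∈ D, ∀ l ≤ n e, _root_.unbordered (k e) (p e) (m e) l < R e := by
    intro e he l hl
    exact Nat.lt_succ_of_le ((unbordered_le (hk₀ e he) (hp₀ e he) l).trans
      (Nat.pow_le_pow_right (hk₀ e he) (by omega)))
  refine hR.keep ?_
  set Γ' := insert R Γ
  have mem : ∀ {g}, g ∈ Γ → g ∈ Γ' := fun h => Or.inr h
  have table : Comp D Γ' (fun e => packed (R e) (_root_.unbordered (k e) (p e) (m e)) (n e))
      (fun e => (n e + 1) ^ 3) := by
    set T : E × ℕ → ℕ :=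
      fun x => packed (R x.1) (_root_.unbordered (k x.1) (p x.1) (m x.1)) x.2 with hT
    have hB : ∀ x ∈ loopDom D n, 1 ≤ (n x.1 + 1) ^ 2 := fun x _ => h1 2 _
    refine loop_one (F := T) (B' := fun e => (n e + 1) ^ 2) 1 (var (fun e _ => h1 3 e) (mem hn))
      ((const (fun e _ => h1 3 e) 0).congr fun e _ => by simp [hT, packed]) ?_ fun e _ => ?_
    · have o : ∀ g ∈ Γ', (fun x => g x.1) ∈ loopCtx Γ' T T := fun g hg => loopCtx_outer hg
      have hU := unbordered_step (D := loopDom D n) (Γ := loopCtx Γ' T T) (j := Prod.snd) (T := T)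
        (N := fun x => n x.1 + 1)
        (o k (mem hk)) (o p (mem hp)) (o m (mem hm)) loopCtx_counter (o R (Or.inl rfl)) loopCtx_fst
        (fun x _ => by omega) (fun x hx => by have := hmn _ hx.1; omega)
        (fun x hx => by have := hx.2; omega) (fun x hx => hk₀ _ hx.1) (fun x hx => hp₀ _ hx.1)
        (fun x hx l hl => hRlt _ hx.1 l (by have := hx.2; omega)) (fun x _ => rfl)
      refine ((var hB loopCtx_fst).add (hU.mul ((var hB (o R (Or.inl rfl))).pow 1
        (var hB loopCtx_counter) fun x hx => ?_))).congr fun x _ => ?_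
      · have := hx.2
        nlinarith
      · exact (Finset.sum_range_succ _ _).symm
    · nlinarith [h1 2 e]
  refine table.keep ?_
  refine (unbordered_step (N := fun e => n e + 1) (R := R) (j := n) (Or.inr (mem hk))
    (Or.inr (mem hp)) (Or.inr (mem hm)) (Or.inr (mem hn)) (Or.inr (Or.inl rfl)) (Or.inl rfl)
    (fun e _ => by omega) (fun e he => by have := hmn e he; omega) (fun e _ => by omega)
    hk₀ hp₀ (fun e he l hl => hRlt e he l hl.le) (fun e _ => rfl)).mono_time 1 fun e _ => ?_
  rw [one_mul]
  exact Nat.pow_le_pow_right (by omega) (by norm_num)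

end RAM.Comp

/-! ### Descent to the word of given rank -/

/-- The test that drives the search: the bordered words with prefix `y` can all be skipped exactly
if the bordered word `x` lies beyond them. That `x` itself is bordered matters: otherwise `x`
could share the count of bordered words below it with smaller numbers. -/
theorem brd_prefix_le_iff {k n m x y : ℕ} (hk : 0 < k) (hmn : m ≤ n) (hy : y < k ^ m)
    (hx : Brd k n x) (hyx : y ≤ x / k ^ (n - m)) :
    k ^ (n - m) - unbordered k y m n ≤
      Nat.count (Brd k n) x - Nat.count (Brd k n) (y * k ^ (n - m)) ↔ y + 1 ≤ x / k ^ (n - m) := by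
  have hK : 0 < k ^ (n - m) := pow_pos hk _
  have h1 := count_brd_prefix hk hy hmn
  have h2 : Nat.count (Brd k n) (y * k ^ (n - m)) ≤ Nat.count (Brd k n) x :=
    Nat.count_monotone _ ((Nat.le_div_iff_mul_le hK).1 hyx)
  rw [Nat.le_div_iff_mul_le hK]
  constructor
  · intro h
    by_contra! hlt
    have := Nat.count_strict_mono hx hlt
    omega
  · intro h
    have := Nat.count_monotone (Brd k n) h
    omega

namespace RAM.Comp

variable {E : Type*} {D : Set E} {Γ : Set (E → ℕ)} {k n r x y z m : E → ℕ}

/-- One step to the right in the search for the next letter, on the prefix and on the number of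
bordered words that are left between the prefix and `x`. -/
theorem descent_step {F G : E → ℕ} (hk : k ∈ Γ) (hn : n ∈ Γ) (hy : y ∈ Γ) (hz : z ∈ Γ)
    (hm : Comp D Γ m (fun e => (n e + 1) ^ 3))
    (hk₀ : ∀ e ∈ D, 0 < k e) (hmn : ∀ e ∈ D, m e ≤ n e) (hy₀ : ∀ e ∈ D, y e < k e ^ m e)
    (hx : ∀ e ∈ D, Brd (k e) (n e) (x e)) (hyx : ∀ e ∈ D, y e ≤ x e / k e ^ (n e - m e))
    (hz₀ : ∀ e ∈ D, z e = Nat.count (Brd (k e) (n e)) (x e) -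
      Nat.count (Brd (k e) (n e)) (y e * k e ^ (n e - m e)))
    (hF : ∀ e ∈ D, F e = min (y e + 1) (x e / k e ^ (n e - m e)))
    (hG : ∀ e ∈ D, G e = Nat.count (Brd (k e) (n e)) (x e) -
      Nat.count (Brd (k e) (n e)) (F e * k e ^ (n e - m e))) :
    Comp D Γ F (fun e => (n e + 1) ^ 3) ∧ Comp D Γ G (fun e => (n e + 1) ^ 3) := by
  have h1 : ∀ e ∈ D, 1 ≤ (n e + 1) ^ 3 := fun e _ => Nat.one_le_pow _ _ (by omega)
  have hK : ∀ {Γ' : Set (E → ℕ)}, Γ ⊆ Γ' →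
      Comp D Γ' (fun e => k e ^ (n e - m e)) (fun e => (n e + 1) ^ 3) := by
    intro Γ' h
    refine pow 1 (var h1 (h hk)) ((var h1 (h hn)).sub (hm.weaken h)) fun e he => ?_
    have := Nat.le_self_pow (show 3 ≠ 0 by norm_num) (n e + 1)
    omega
  have hc : Comp D (insert m Γ) (fun e => k e ^ (n e - m e) -
      _root_.unbordered (k e) (y e) (m e) (n e)) (fun e => (n e + 1) ^ 3) :=
    (hK (Set.subset_insert _ _)).sub
      (unbordered (Or.inr hk) (Or.inr hy) (Or.inl rfl) (Or.inr hn) hk₀ hy₀ hmn)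
  have hc' := hm.keep hc
  constructor
  · refine (hc'.ite_le (var h1 hz) ((var h1 hy).add (const h1 1)) (var h1 hy)).congr
      fun e he => ?_
    have := brd_prefix_le_iff (hk₀ e he) (hmn e he) (hy₀ e he) (hx e he) (hyx e he)
    have := hyx e he
    rw [hF e he, hz₀ e he]
    split_ifs <;> omega
  · refine (hc'.ite_le (var h1 hz) ((var h1 hz).sub hc') (var h1 hz)).congr fun e he => ?_
    have h2 := brd_prefix_le_iff (hk₀ e he) (hmn e he) (hy₀ e he) (hx e he) (hyx e he)
    have h3 := hyx e he
    have h4 := count_brd_prefix (hk₀ e he) (hy₀ e he) (hmn e he)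
    rw [hG e he, hF e he, hz₀ e he]
    split_ifs with h
    · rw [min_eq_left (h2.1 h), h4]
      omega
    · rw [min_eq_right (by omega), show x e / k e ^ (n e - m e) = y e by omega]

/-- The search for the letter at position `m`: from the prefix of length `m` of `x` to the
prefix of length `m + 1`. -/
theorem descent_letter (hk : k ∈ Γ) (hn : n ∈ Γ) (hm : m ∈ Γ) (hy : y ∈ Γ) (hz : z ∈ Γ)
    (hk₀ : ∀ e ∈ D, 0 < k e) (hmn : ∀ e ∈ D, m e < n e) (hxn : ∀ e ∈ D, x e < k e ^ n e)
    (hx : ∀ e ∈ D, Brd (k e) (n e) (x e)) (hy₀ : ∀ e ∈ D, y e = x e / k e ^ (n e - m e))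
    (hz₀ : ∀ e ∈ D, z e = Nat.count (Brd (k e) (n e)) (x e) -
      Nat.count (Brd (k e) (n e)) (y e * k e ^ (n e - m e))) :
    Comp D Γ (fun e => x e / k e ^ (n e - (m e + 1))) (fun e => (n e + 1) ^ 3 * k e) ∧
    Comp D Γ (fun e => Nat.count (Brd (k e) (n e)) (x e) - Nat.count (Brd (k e) (n e))
      (x e / k e ^ (n e - (m e + 1)) * k e ^ (n e - (m e + 1))))
      (fun e => (n e + 1) ^ 3 * k e) := by
  have h1 : ∀ e ∈ D, 1 ≤ (n e + 1) ^ 3 * k e := fun e he =>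
    Nat.mul_pos (pow_pos (by omega) _) (hk₀ e he)
  have hpow : ∀ e ∈ D, k e ^ (n e - m e) = k e ^ (n e - (m e + 1)) * k e := fun e he => by
    have := hmn e he
    rw [← pow_succ]
    congr 1
    omega
  have hyk : ∀ e ∈ D, y e * k e ≤ x e / k e ^ (n e - (m e + 1)) ∧
      x e / k e ^ (n e - (m e + 1)) < y e * k e + k e := fun e he => by
    rw [hy₀ e he, hpow e he, ← Nat.div_div_eq_div_mul]
    exact ⟨Nat.div_mul_le_self _ _, Nat.lt_div_mul_add (hk₀ e he)⟩
  -- after `v.2` rounds the prefix has moved `v.2` steps, unless it has reached that of `x` before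
  set F : E × ℕ → ℕ := fun v =>
    min (y v.1 * k v.1 + v.2) (x v.1 / k v.1 ^ (n v.1 - (m v.1 + 1))) with hF
  set G : E × ℕ → ℕ := fun v => Nat.count (Brd (k v.1) (n v.1)) (x v.1) -
    Nat.count (Brd (k v.1) (n v.1)) (F v * k v.1 ^ (n v.1 - (m v.1 + 1))) with hG
  have hF₀ : Comp D Γ (fun e => F (e, 0)) (fun e => (n e + 1) ^ 3 * k e) := by
    refine ((var h1 hy).mul (var h1 hk)).congr fun e he => ?_
    have := (hyk e he).1
    simp only [hF]
    omega
  have hG₀ : Comp D Γ (fun e => G (e, 0)) (fun e => (n e + 1) ^ 3 * k e) := by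
    refine (var h1 hz).congr fun e he => ?_
    have := (hyk e he).1
    simp only [hG, hF, hz₀ e he, hpow e he, add_zero]
    rw [min_eq_left this]
    congr 2
    ring
  have step : Comp (loopDom D k) (loopCtx Γ F G) (fun v => F (v.1, v.2 + 1))
      (fun v => (n v.1 + 1) ^ 3) ∧ Comp (loopDom D k) (loopCtx Γ F G)
      (fun v => G (v.1, v.2 + 1)) (fun v => (n v.1 + 1) ^ 3) := by
    have hB : ∀ v ∈ loopDom D k, 1 ≤ (n v.1 + 1) ^ 3 := fun v _ => Nat.one_le_pow _ _ (by omega)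
    refine descent_step (y := F) (z := G) (x := fun v => x v.1) (m := fun v => m v.1 + 1)
      (k := fun v => k v.1) (n := fun v => n v.1)
      (loopCtx_outer hk) (loopCtx_outer hn) loopCtx_fst loopCtx_snd
      ((var hB (loopCtx_outer hm)).add (const hB 1)) (fun v hv => hk₀ _ hv.1)
      (fun v hv => hmn _ hv.1) (fun v hv => ?_) (fun v hv => hx _ hv.1)
      (fun v hv => min_le_right _ _) (fun v _ => rfl) (fun v hv => ?_) (fun v _ => rfl)
    · refine (min_le_right _ _).trans_lt (Nat.div_lt_of_lt_mul ?_)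
      have := hmn _ hv.1
      rw [← pow_add, show n v.1 - (m v.1 + 1) + (m v.1 + 1) = n v.1 by omega]
      exact hxn _ hv.1
    · simp only [hF]
      omega
  have hB : ∀ e ∈ D, k e * (n e + 1) ^ 3 ≤ 1 * ((n e + 1) ^ 3 * k e) := fun e _ => by
    rw [one_mul, mul_comm]
  have hend : ∀ e ∈ D, F (e, k e) = x e / k e ^ (n e - (m e + 1)) := fun e he =>
    min_eq_right (hyk e he).2.le
  constructor
  · exact (loop 1 (var h1 hk) hF₀ hG₀ step.1 step.2 hB).congr hend
  -- the other running value of the same loop, which is run a second time to obtain it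
  · rw [loopCtx_comm] at step
    refine (loop 1 (var h1 hk) hG₀ hF₀ step.2 step.1 hB).congr fun e he => ?_
    simp only [hG, hend e he]

/-- The bordered word with a given rank is found letter by letter. -/
theorem unrank (hk : k ∈ Γ) (hn : n ∈ Γ) (hr : r ∈ Γ)
    (hk₀ : ∀ e ∈ D, 0 < k e) (hxn : ∀ e ∈ D, x e < k e ^ n e)
    (hx : ∀ e ∈ D, Brd (k e) (n e) (x e))
    (hr₀ : ∀ e ∈ D, r e = Nat.count (Brd (k e) (n e)) (x e) + 1) :
    Comp D Γ x (fun e => (n e + 1) ^ 4 * k e) := by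
  have h1 : ∀ e ∈ D, 1 ≤ (n e + 1) ^ 4 * k e := fun e he =>
    Nat.mul_pos (pow_pos (by omega) _) (hk₀ e he)
  set F : E × ℕ → ℕ := fun v => x v.1 / k v.1 ^ (n v.1 - v.2) with hF
  set G : E × ℕ → ℕ := fun v => Nat.count (Brd (k v.1) (n v.1)) (x v.1) -
    Nat.count (Brd (k v.1) (n v.1)) (F v * k v.1 ^ (n v.1 - v.2)) with hG
  have hF₀ : ∀ e ∈ D, F (e, 0) = 0 := fun e he => Nat.div_eq_of_lt (hxn e he)
  have step := descent_letter (D := loopDom D n) (Γ := loopCtx Γ F G) (k := fun v => k v.1)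
    (n := fun v => n v.1) (m := Prod.snd) (y := F) (z := G) (x := fun v => x v.1)
    (loopCtx_outer hk) (loopCtx_outer hn) loopCtx_counter loopCtx_fst loopCtx_snd
    (fun v hv => hk₀ _ hv.1) (fun v hv => hv.2) (fun v hv => hxn _ hv.1) (fun v hv => hx _ hv.1)
    (fun v _ => rfl) (fun v _ => rfl)
  refine (loop (F := F) (G := G) (B' := fun e => (n e + 1) ^ 3 * k e) 1 (var h1 hn)
    ((const h1 0).congr fun e he => (hF₀ e he).symm)
    (((var h1 hr).sub (const h1 1)).congr fun e he => ?_) step.1 step.2 fun e _ => ?_).congr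
    fun e _ => ?_
  · simp [hG, hF₀ e he, hr₀ e he]
  · calc n e * ((n e + 1) ^ 3 * k e) ≤ (n e + 1) * ((n e + 1) ^ 3 * k e) :=
        Nat.mul_le_mul_right _ (by omega)
      _ = 1 * ((n e + 1) ^ 4 * k e) := by ring
  · simp [hF]

end RAM.Comp

/-! ### Words as numbers -/

/-- The number whose base-`k` digits, most significant first, are the letters of the word, each
diminished by one. -/
def wordNum {k : ℕ} : List (Letter k) → ℕ
  | [] => 0
  | a :: l => (a.1 - 1) * k ^ l.length + wordNum l

theorem Letter.pos {k : ℕ} (a : Letter k) : 1 ≤ a.1 := (Finset.mem_Icc.1 a.2).1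

theorem Letter.le {k : ℕ} (a : Letter k) : a.1 ≤ k := (Finset.mem_Icc.1 a.2).2

theorem wordNum_append {k : ℕ} (u v : List (Letter k)) :
    wordNum (u ++ v) = wordNum u * k ^ v.length + wordNum v := by
  induction u with
  | nil => simp [wordNum]
  | cons a u ih =>
    simp only [List.cons_append, wordNum, ih, List.length_append, pow_add]
    ring

theorem wordNum_lt {k : ℕ} (u : List (Letter k)) : wordNum u < k ^ u.length := by
  induction u with
  | nil => simp [wordNum]
  | cons a u ih =>
    have h1 : a.1 - 1 + 1 ≤ k := by have := a.pos; have := a.le; omega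
    have h2 := Nat.mul_le_mul_right (k ^ u.length) h1
    rw [wordNum, List.length_cons, pow_succ]
    nlinarith

theorem wordNum_lt_iff {k : ℕ} {u v : List (Letter k)} (h : u.length = v.length) :
    u < v ↔ wordNum u < wordNum v := by
  induction u generalizing v with
  | nil =>
    obtain rfl : v = [] := List.length_eq_zero_iff.1 h.symm
    simp [wordNum]
  | cons a u ih =>
    obtain _ | ⟨b, v⟩ := v
    · simp at h
    have huv : u.length = v.length := by simpa using h
    have hu := wordNum_lt u
    have hv := wordNum_lt v
    rw [List.cons_lt_cons_iff, ih huv, wordNum, wordNum, huv]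
    rw [huv] at hu
    have ha := a.pos
    have hb := b.pos
    rcases lt_trichotomy a b with hab | rfl | hab
    · have hab' : a.1 - 1 + 1 ≤ b.1 - 1 := by
        have : a.1 < b.1 := hab
        omega
      have := Nat.mul_le_mul_right (k ^ v.length) hab'
      simp only [hab, true_or, true_iff]
      nlinarith
    · simp
    · have hab' : b.1 - 1 + 1 ≤ a.1 - 1 := by
        have : b.1 < a.1 := hab
        omega
      have := Nat.mul_le_mul_right (k ^ v.length) hab'
      simp only [hab.not_gt, hab.ne', false_and, or_self, false_iff, not_lt]
      nlinarith

theorem wordNum_inj {k : ℕ} {u v : List (Letter k)} (h : u.length = v.length)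
    (huv : wordNum u = wordNum v) : u = v := by
  rcases lt_trichotomy u v with h' | h' | h'
  · exact absurd ((wordNum_lt_iff h).1 h') huv.not_lt
  · exact h'
  · exact absurd ((wordNum_lt_iff h.symm).1 h') huv.not_gt

theorem exists_wordNum_eq {k : ℕ} (n : ℕ) {x : ℕ} (hx : x < k ^ n) :
    ∃ w : List (Letter k), w.length = n ∧ wordNum w = x := by
  induction n generalizing x with
  | zero => exact ⟨[], rfl, by simp at hx; simp [wordNum, hx]⟩
  | succ n ih =>
    have hk : 0 < k ^ n := by
      rcases Nat.eq_zero_or_pos (k ^ n) with h | h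
      · rw [pow_succ, h] at hx; omega
      · exact h
    obtain ⟨w, hw, hwx⟩ := ih (Nat.mod_lt x hk)
    have h1 : x / k ^ n < k := Nat.div_lt_of_lt_mul (by rwa [← pow_succ])
    refine ⟨⟨x / k ^ n + 1, Finset.mem_Icc.2 ⟨Nat.succ_pos _, h1⟩⟩ :: w, by simp [hw], ?_⟩
    rw [wordNum, hw, hwx, Nat.add_sub_cancel, mul_comm, Nat.div_add_mod]

theorem wordNum_append_div {k : ℕ} (u v : List (Letter k)) :
    wordNum (u ++ v) / k ^ v.length = wordNum u := by
  have := wordNum_lt v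
  rw [wordNum_append, mul_comm, Nat.mul_add_div (by omega), Nat.div_eq_of_lt this, add_zero]

theorem wordNum_append_mod {k : ℕ} (u v : List (Letter k)) :
    wordNum (u ++ v) % k ^ v.length = wordNum v := by
  rw [wordNum_append, mul_comm, Nat.mul_add_mod, Nat.mod_eq_of_lt (wordNum_lt v)]

/-- The letters of a word are recovered as digits. -/
theorem wordNum_digit {k : ℕ} (w : List (Letter k)) (i : ℕ) (hi : i < w.length) :
    wordNum w / k ^ (w.length - 1 - i) % k + 1 = (w[i]).1 := by
  have h1 : w = w.take i ++ [w[i]] ++ w.drop (i + 1) := by simp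
  have h2 : (w.drop (i + 1)).length = w.length - 1 - i := by simp; omega
  have h3 := wordNum_append_mod (w.take i) [w[i]]
  have := (w[i]).pos
  have h4 := wordNum_append_div (w.take i ++ [w[i]]) (w.drop (i + 1))
  rw [← h1, h2] at h4
  rw [List.length_singleton, pow_one] at h3
  rw [h4, h3]
  simp [wordNum]
  omega

theorem bordered_iff {k : ℕ} (w : List (Letter k)) :
    Bordered w ↔ Brd k w.length (wordNum w) := by
  constructor
  · rintro ⟨u, hne, hnw, ⟨v, hv⟩, ⟨v', hv'⟩⟩
    have hlen : v'.length = v.length := by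
      have h1 := congrArg List.length hv
      have h2 := congrArg List.length hv'
      simp only [List.length_append] at h1 h2
      omega
    have hu : 0 < u.length := List.length_pos_iff.2 hne
    have hv0 : 0 < v.length := by
      refine List.length_pos_iff.2 fun h => hnw ?_
      rw [← hv, h, List.append_nil]
    have hw : w.length = u.length + v.length := by rw [← hv, List.length_append]
    refine ⟨u.length, Finset.mem_Ico.2 ⟨hu, by omega⟩, ?_⟩
    rw [show w.length - u.length = v.length by omega]
    conv_lhs => rw [← hv, wordNum_append_div]
    rw [← hv', wordNum_append_mod]
  · rintro ⟨i, hi, h⟩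
    rw [Finset.mem_Ico] at hi
    have h1 : (w.drop i).length = w.length - i := List.length_drop
    have h2 : (w.drop (w.length - i)).length = i := by simp; omega
    have e1 : wordNum w / k ^ (w.length - i) = wordNum (w.take i) := by
      have := wordNum_append_div (w.take i) (w.drop i)
      rwa [List.take_append_drop, h1] at this
    have e2 : wordNum w % k ^ i = wordNum (w.drop (w.length - i)) := by
      have := wordNum_append_mod (w.take (w.length - i)) (w.drop (w.length - i))
      rwa [List.take_append_drop, h2] at this
    have e3 : w.take i = w.drop (w.length - i) :=
      wordNum_inj (by simp; omega) (by rw [← e1, ← e2, h])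
    refine ⟨w.take i, ?_, ?_, List.take_prefix _ _, by rw [e3]; exact List.drop_suffix _ _⟩
    · intro h
      have := congrArg List.length h
      rw [List.length_take, List.length_nil] at this
      omega
    · intro h
      have := congrArg List.length h
      rw [List.length_take] at this
      omega

theorem mem_words {n k : ℕ} {w : List (Letter k)} : w ∈ words n k ↔ w.length = n := by
  simp only [words, Finset.mem_image, Finset.mem_univ, true_and]
  constructor
  · rintro ⟨f, rfl⟩
    simp
  · rintro rfl
    exact ⟨w.get, List.ofFn_get w⟩

theorem idxOf_eq_length_filter {α : Type*} [LinearOrder α] [BEq α] [LawfulBEq α] {l : List α}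
    (hl : l.Pairwise (· < ·)) {a : α} (ha : a ∈ l) :
    l.idxOf a = (l.filter (· < a)).length := by
  induction l with
  | nil => simp at ha
  | cons b l ih =>
    rw [List.pairwise_cons] at hl
    rcases eq_or_ne b a with rfl | hba
    · have : l.filter (· < b) = [] := by
        rw [List.filter_eq_nil_iff]
        intro c hc
        simpa using (hl.1 c hc).le
      simp [this]
    · have ha' : a ∈ l := (List.mem_cons.1 ha).resolve_left hba.symm
      rw [List.idxOf_cons_ne _ hba, ih hl.2 ha',
        List.filter_cons_of_pos (by simpa using hl.1 a ha')]
      rfl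

theorem mem_borderedListing {n k : ℕ} {w : List (Letter k)} :
    w ∈ borderedListing n k ↔ w.length = n ∧ Bordered w := by
  simp [borderedListing, mem_words]

/-- The rank of a bordered word counts the smaller numbers of bordered words. -/
theorem rankB_eq {k : ℕ} {w : List (Letter k)} (hw : Bordered w) :
    rankB w = Nat.count (Brd k w.length) (wordNum w) + 1 := by
  classical
  have hsort : (borderedListing w.length k).Pairwise (· < ·) :=
    (((Finset.pairwise_sort _ (· ≤ ·)).and (Finset.sort_nodup _ _)).imp
      fun h => lt_of_le_of_ne h.1 h.2)
  have hnodup : (borderedListing w.length k).Nodup := Finset.sort_nodup _ _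
  rw [rankB, idxOf_eq_length_filter hsort (mem_borderedListing.2 ⟨rfl, hw⟩),
    Nat.count_eq_card_filter_range]
  congr 1
  rw [← List.toFinset_card_of_nodup (hnodup.filter _)]
  refine Finset.card_bij (fun v _ => wordNum v) ?_ ?_ ?_
  · intro v hv
    simp only [List.mem_toFinset, List.mem_filter, mem_borderedListing,
      decide_eq_true_eq] at hv
    obtain ⟨⟨h1, h2⟩, h3⟩ := hv
    rw [Finset.mem_filter, Finset.mem_range]
    exact ⟨(wordNum_lt_iff h1).1 h3, by rw [← h1]; exact (bordered_iff v).1 h2⟩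
  · intro v hv v' hv' h
    simp only [List.mem_toFinset, List.mem_filter, mem_borderedListing] at hv hv'
    exact wordNum_inj (hv.1.1.trans hv'.1.1.symm) h
  · intro x hx
    rw [Finset.mem_filter, Finset.mem_range] at hx
    obtain ⟨v, h1, rfl⟩ := exists_wordNum_eq w.length (hx.1.trans (wordNum_lt w))
    refine ⟨v, ?_, rfl⟩
    simp only [List.mem_toFinset, List.mem_filter, mem_borderedListing, decide_eq_true_eq]
    exact ⟨⟨h1, by rw [bordered_iff, h1]; exact hx.2⟩, (wordNum_lt_iff h1).2 hx.1⟩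

/-! ### The complete program -/

namespace RAM

/-- A problem instance: the input `(r, n, k)`, together with the number `x` of the word
to be found. -/
structure Inst : Type where
  r : ℕ
  n : ℕ
  k : ℕ
  x : ℕ

/-- The instances in which `x` is the number of the bordered word of rank `r`. -/
def Inst.valid : Set Inst :=
  {e | 0 < e.k ∧ e.x < e.k ^ e.n ∧ Brd e.k e.n e.x ∧ e.r = Nat.count (Brd e.k e.n) e.x + 1}

theorem comp_wordNumber :
    Comp Inst.valid {Inst.r, Inst.n, Inst.k} Inst.x (fun e => (e.n + 1) ^ 4 * e.k) :=
  Comp.unrank (k := Inst.k) (n := Inst.n) (r := Inst.r) (by simp) (by simp) (by simp)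
    (fun _ h => h.1) (fun _ h => h.2.1) (fun _ h => h.2.2.1) (fun _ h => h.2.2.2)

/-- The letter at position `v.2` of the word to be found, for the output loop. -/
theorem comp_letter :
    Comp (Comp.loopDom Inst.valid Inst.n)
      {(fun v => v.1.n), (fun v => v.1.k), (fun v => v.1.x), Prod.snd}
      (fun v => v.1.x / v.1.k ^ (v.1.n - 1 - v.2) % v.1.k + 1) (fun v => v.1.n + 1) := by
  set Γ : Set (Inst × ℕ → ℕ) := {(fun v => v.1.n), (fun v => v.1.k), (fun v => v.1.x), Prod.snd}
  have hB : ∀ v ∈ Comp.loopDom Inst.valid Inst.n, 1 ≤ v.1.n + 1 := fun _ _ => by omega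
  have hn : Comp (Comp.loopDom Inst.valid Inst.n) Γ (fun v => v.1.n) (fun v => v.1.n + 1) :=
    .var hB (by simp [Γ])
  have hk : Comp (Comp.loopDom Inst.valid Inst.n) Γ (fun v => v.1.k) (fun v => v.1.n + 1) :=
    .var hB (by simp [Γ])
  have hx : Comp (Comp.loopDom Inst.valid Inst.n) Γ (fun v => v.1.x) (fun v => v.1.n + 1) :=
    .var hB (by simp [Γ])
  have hi : Comp (Comp.loopDom Inst.valid Inst.n) Γ Prod.snd (fun v => v.1.n + 1) :=
    .var hB (by simp [Γ])
  exact ((hx.div (hk.pow 1 ((hn.sub (.const hB 1)).sub hi) fun v _ => by omega)).mod hk).add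
    (.const hB 1)

/-- The program: the number `x` is computed in register `3`, then its digits are written to the
registers from `A` on, where `A` is above all registers used before. In the
output loop register `4` is the counter, register `5` holds `1`, register `6` the next address. -/
theorem exists_program : ∃ (P : Program) (A c : ℕ), ∀ e ∈ Inst.valid, ∃ m',
    Reaches P (A + e.n) (init [e.r, e.n, e.k]) ⟨P.length, m'⟩ (c * ((e.n + 1) ^ 4 * e.k)) ∧
    m' 0 = A ∧
    ∀ j < e.n, m' (A + j) = e.x / e.k ^ (e.n - 1 - j) % e.k + 1 := by
  classical
  set ρ : (Inst → ℕ) → ℕ := fun g => if g = Inst.r then 0 else if g = Inst.n then 1 else 2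
    with hρ
  obtain ⟨c₁, K₁, t₁, hK₁, H₁⟩ := comp_wordNumber.2 ρ 3 0 fun g _ => by
    simp only [hρ]; split_ifs <;> omega
  set ρ' : (Inst × ℕ → ℕ) → ℕ := fun g => if g = (fun v => v.1.n) then 1 else
    if g = (fun v => v.1.k) then 2 else if g = (fun v => v.1.x) then 3 else 4 with hρ'
  set L := c₁.length + 3 with hL
  obtain ⟨c₂, K₂, t₂, hK₂, H₂⟩ := comp_letter.2 ρ' 7 (L + 1) fun g _ => by
    simp only [hρ']; split_ifs <;> omega
  set A := max K₁ K₂ with hA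
  set L' := L + 1 + c₂.length with hL'
  set P : Program := c₁ ++ [Instr.const 4 0, Instr.const 5 1, Instr.const 6 A] ++
    [Instr.jumpLE 1 4 (L' + 4)] ++ c₂ ++
    [Instr.store 6 7, Instr.add 4 4 5, Instr.add 6 6 5, Instr.jump L, Instr.const 0 A] with hP
  have hPlen : P.length = L' + 5 := by
    simp only [hP, List.length_append, List.length_cons, List.length_nil]
    omega
  refine ⟨P, A, t₁ + t₂ + 10, fun e he => ?_⟩
  have code := codeAt_self P
  rw [hP] at code
  simp only [codeAt_append, codeAt_cons, List.length_append, List.length_cons, List.length_nil,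
    ← Nat.add_assoc, Nat.zero_add] at code
  rw [← hP] at code
  obtain ⟨⟨⟨⟨hc₁, hi₁, hi₂, hi₃, -⟩, hi₄, -⟩, hc₂⟩, hi₅, hi₆, hi₇, hi₈, hi₉, -⟩ := code
  obtain ⟨m₁, r₁, v₁, p₁⟩ := H₁ P hc₁ e he (init [e.r, e.n, e.k]).mem fun g hg => by
    simp only [hρ]
    split_ifs with h1 h2
    · simp [init, h1]
    · simp [init, h2]
    · have : g = Inst.k := by simpa [h1, h2] using hg
      simp [init, this]
  set K := A + e.n with hK
  set m₂ := Function.update m₁ 4 0 with hm₂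
  set m₃ := Function.update m₂ 5 1 with hm₃
  set m₀ := Function.update m₃ 6 A with hm₀
  have w₁ : Reaches P K ⟨c₁.length, m₁⟩ ⟨c₁.length + 1, m₂⟩ 1 := by
    refine Reaches.write hi₁ ?_ ?_ (by omega)
    · simp [Instr.exec, Config.write]
    · simp [Instr.touched]; omega
  have w₂ : Reaches P K ⟨c₁.length + 1, m₂⟩ ⟨c₁.length + 1 + 1, m₃⟩ 1 := by
    refine Reaches.write hi₂ ?_ ?_ (by omega)
    · simp [Instr.exec, Config.write]
    · simp [Instr.touched]; omega
  have w₃ : Reaches P K ⟨c₁.length + 1 + 1, m₃⟩ ⟨L, m₀⟩ 1 := by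
    refine Reaches.write hi₃ ?_ ?_ (by omega)
    · simp [Instr.exec, Config.write]
    · simp [Instr.touched]; omega
  have inv : ∀ i ≤ e.n, ∃ m, Reaches P K ⟨L, m₀⟩ ⟨L, m⟩ (i * ((t₂ + 5) * (e.n + 1))) ∧
      m 1 = e.n ∧ m 2 = e.k ∧ m 3 = e.x ∧ m 4 = i ∧ m 5 = 1 ∧ m 6 = A + i ∧
      ∀ j < i, m (A + j) = e.x / e.k ^ (e.n - 1 - j) % e.k + 1 := by
    intro i
    induction i with
    | zero =>
      refine fun _ => ⟨m₀, by simpa using Reaches.refl P K _, ?_, ?_, ?_, ?_, ?_, ?_, by simp⟩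
      · simp [hm₀, hm₃, hm₂, p₁ 1 (by omega), init]
      · simp [hm₀, hm₃, hm₂, p₁ 2 (by omega), init]
      · simp [hm₀, hm₃, hm₂, v₁]
      · simp [hm₀, hm₃, hm₂]
      · simp [hm₀, hm₃]
      · simp [hm₀]
    | succ i ih =>
      intro hi
      obtain ⟨m, r, u₁, u₂, u₃, u₄, u₅, u₆, u⟩ := ih (by omega)
      clear ih
      have rj := Reaches.jumpLE (K := K) (m := m) hi₄ (by omega) (by omega)
      rw [u₁, u₄, if_neg (by omega)] at rj
      obtain ⟨m', r', v', p'⟩ := H₂ P hc₂ (e, i) ⟨he, hi⟩ m fun g hg => by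
        simp only [hρ']
        split_ifs with h1 h2 h3
        · rw [u₁, h1]
        · rw [u₂, h2]
        · rw [u₃, h3]
        · have : g = Prod.snd := by simpa [h1, h2, h3] using hg
          rw [u₄, this]
      have q' : ∀ j < i, m' (A + j) = m (A + j) := by
        obtain ⟨-, -, -, -, h⟩ := r'
        exact fun j _ => h (A + j) (by omega)
      set d := e.x / e.k ^ (e.n - 1 - i) % e.k + 1 with hd
      set m₄ := Function.update m' (A + i) d with hm₄
      set m₅ := Function.update m₄ 4 (i + 1) with hm₅
      set m₆ := Function.update m₅ 6 (A + i + 1) with hm₆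
      have f₄ : ∀ a < 7, m₄ a = m a := fun a ha => by
        rw [hm₄, Function.update_of_ne (by omega), p' a ha]
      have x₁ : Reaches P K ⟨L', m'⟩ ⟨L' + 1, m₄⟩ 1 := by
        refine Reaches.write hi₅ ?_ ?_ (by omega)
        · simp [Instr.exec, Config.write, p' 6 (by omega), u₆, v', hd]
        · simp [Instr.touched, p' 6 (by omega), u₆]; omega
      have x₂ : Reaches P K ⟨L' + 1, m₄⟩ ⟨L' + 1 + 1, m₅⟩ 1 := by
        refine Reaches.write hi₆ ?_ ?_ (by omega)
        · simp [Instr.exec, Config.write, f₄ 4 (by omega), f₄ 5 (by omega), u₄, u₅]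
        · simp [Instr.touched]; omega
      have x₃ : Reaches P K ⟨L' + 1 + 1, m₅⟩ ⟨L' + 1 + 1 + 1, m₆⟩ 1 := by
        refine Reaches.write hi₇ ?_ ?_ (by omega)
        · simp [Instr.exec, Config.write, hm₅, f₄ 6 (by omega), f₄ 5 (by omega), u₆, u₅]
        · simp [Instr.touched]; omega
      refine ⟨m₆, ?_, ?_, ?_, ?_, ?_, ?_, ?_, fun j hj => ?_⟩
      · have r'' := r'.mono (show K₂ ≤ K by omega) le_rfl
        refine ((((((r.trans rj).trans r'').trans x₁).trans x₂).trans x₃).trans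
          (Reaches.jump hi₈)).mono le_rfl ?_
        simp only
        nlinarith
      · simp [hm₆, hm₅, f₄ 1, u₁]
      · simp [hm₆, hm₅, f₄ 2, u₂]
      · simp [hm₆, hm₅, f₄ 3, u₃]
      · simp [hm₆, hm₅]
      · simp [hm₆, hm₅, f₄ 5, u₅]
      · simp [hm₆, Nat.add_assoc]
      · rw [hm₆, Function.update_of_ne (by omega), hm₅, Function.update_of_ne (by omega), hm₄]
        rcases Nat.lt_succ_iff_lt_or_eq.1 hj with h | rfl
        · rw [Function.update_of_ne (by omega), q' j h, u j h]
        · rw [Function.update_self]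
  obtain ⟨m, r, u₁, -, -, u₄, -, -, u⟩ := inv e.n le_rfl
  have rj := Reaches.jumpLE (K := K) (m := m) hi₄ (by omega) (by omega)
  rw [u₁, u₄, if_pos le_rfl] at rj
  have w₄ : Reaches P K ⟨L' + 4, m⟩ ⟨L' + 4 + 1, Function.update m 0 A⟩ 1 := by
    refine Reaches.write hi₉ ?_ ?_ (by omega)
    · simp [Instr.exec, Config.write]
    · simp [Instr.touched]; omega
  refine ⟨Function.update m 0 A, ?_, by simp, fun j hj => ?_⟩
  · rw [hPlen]
    have r₁' := r₁.mono (show K₁ ≤ K by omega) le_rfl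
    rw [Nat.zero_add] at r₁'
    refine ((((((r₁'.trans w₁).trans w₂).trans w₃).trans r).trans rj).trans w₄).mono le_rfl ?_
    have h1 : (e.n + 1) ^ 2 ≤ (e.n + 1) ^ 4 * e.k :=
      (Nat.pow_le_pow_right (by omega) (by norm_num)).trans (Nat.le_mul_of_pos_right _ he.1)
    have h2 : e.n * (e.n + 1) ≤ (e.n + 1) ^ 2 := by nlinarith
    have h3 : 1 ≤ (e.n + 1) ^ 2 := Nat.one_le_pow _ _ (by omega)
    have h4 := Nat.mul_le_mul_left (t₂ + 5) (h2.trans h1)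
    nlinarith
  · rw [Function.update_of_ne (by omega)]
    exact u j hj

end RAM

/-- One fixed unit-cost RAM program computes, from the rank `r`, the length `n` and the alphabet
size `k`, the bordered word of length `n` over `Σ_k` with rank `r`, in `O(n^4 k log k)` time and
`O(n)` space. -/
theorem theorem11 :
    ∃ (P : RAM.Program) (C : ℝ), 0 < C ∧
      ∀ n k : ℕ, 1 ≤ n → 2 ≤ k →
        ∀ (r : ℕ) (w : List (Letter k)), w.length = n → Bordered w → rankB w = r →
          RAM.Computes P [r, n, k] (w.map Subtype.val)
            (C * ((n : ℝ) ^ 4 * (k : ℝ) * Real.log k)) (C * (n : ℝ)) := by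
  obtain ⟨P, A, c, H⟩ := RAM.exists_program
  have hlog : 0 < Real.log 2 := Real.log_pos (by norm_num)
  -- `(n + 1) ^ 4 ≤ 16 * n ^ 4` and `log 2 ≤ log k` give the time, `A + n ≤ (A + 1) * n` and the
  -- three input registers give the space
  refine ⟨P, 16 * c / Real.log 2 + A + 3, by positivity, ?_⟩
  rintro n k hn hk r w rfl hw rfl
  obtain ⟨m, ⟨t, ht, hrun, htouch, -⟩, h0, hout⟩ :=
    H ⟨rankB w, w.length, k, wordNum w⟩
      ⟨by simp only; omega, wordNum_lt w, (bordered_iff w).1 hw, rankB_eq hw⟩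
  simp only at ht hrun htouch h0 hout
  have hn' : (1 : ℝ) ≤ w.length := by exact_mod_cast hn
  have hC : (0 : ℝ) ≤ 16 * c / Real.log 2 := by positivity
  have hA : (0 : ℝ) ≤ A := Nat.cast_nonneg _
  have hspace : ((A + w.length : ℕ) : ℝ) ≤ (16 * c / Real.log 2 + A + 3) * w.length := by
    push_cast
    nlinarith [mul_nonneg hC (zero_le_one.trans hn'), mul_nonneg hA (sub_nonneg.2 hn')]
  refine ⟨t, ?_, ?_, fun i => ?_, ?_, ?_, fun s hs a ha => ?_⟩
  · have h1 : ((w.length + 1) ^ 4 : ℕ) ≤ 16 * w.length ^ 4 := by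
      calc (w.length + 1) ^ 4 ≤ (2 * w.length) ^ 4 := Nat.pow_le_pow_left (by omega) 4
        _ = 16 * w.length ^ 4 := by ring
    have h2 : t ≤ 16 * c * (w.length ^ 4 * k) := by
      calc t ≤ c * ((w.length + 1) ^ 4 * k) := ht
        _ ≤ c * (16 * w.length ^ 4 * k) := by gcongr
        _ = _ := by ring
    have h3 : (t : ℝ) ≤ 16 * c * ((w.length : ℝ) ^ 4 * k) := by exact_mod_cast h2
    have h4 : Real.log 2 ≤ Real.log k := Real.log_le_log (by norm_num) (by exact_mod_cast hk)
    calc (t : ℝ) ≤ 16 * c * ((w.length : ℝ) ^ 4 * k) := h3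
      _ = 16 * c / Real.log 2 * ((w.length : ℝ) ^ 4 * k * Real.log 2) := by field_simp
      _ ≤ (16 * c / Real.log 2 + A + 3) * ((w.length : ℝ) ^ 4 * k * Real.log k) := by
        gcongr
        linarith
  · rw [hrun]
    exact le_rfl
  · have hi : (i : ℕ) < w.length := by simpa using i.2
    rw [hrun]
    simp only
    rw [h0, hout i hi, wordNum_digit w i hi]
    simp
  · simp only [List.length_cons, List.length_nil]
    push_cast
    nlinarith [mul_nonneg hA (zero_le_one.trans hn')]
  · rw [hrun]
    simp only
    rw [h0, List.length_map]
    exact hspace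
  · exact lt_of_lt_of_le (by exact_mod_cast htouch s hs a ha) hspace
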